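/- Let $1\le M\le N$ and $L\ge 1$ be integers, let $\mathbf R\in\mathbb C^{M\times M}$ be Hermitian positive definite with eigendecomposition $\mathbf R=\mathbf U\,\mathrm{diag}(\lambda_1,\dots,\lambda_M)\,\mathbf U^{\mathsf H}$, $\mathbf U=[\mathbf u_1\dots\mathbf u_M]$ unitary, and let $p>0$ be a power budget. In the sensing-centric (S-C) design the precoding matrix is $\mathbf P_{\rm s}=\mathbf U\,\mathrm{diag}(q_1,\dots,q_M)^{1/2}$, with $q_i\ge 0$ chosen so that $\mathbf P_{\rm s}$ maximizes the sensing rate $\frac ML\log_2\det(\mathbf I_M+L\mathbf P^{\mathsf H}\mathbf R\mathbf P)$ over all $\mathbf P\in\mathbb C^{M\times M}$ with $\mathrm{tr}(\mathbf P\mathbf P^{\mathsf H})\le p$. Let $s_i^\star=\max\{0,\frac1\nu-\frac1{L\lambda_i}\}$, where $\nu$ is such that $\sum_{i=1}^M s_i^\star=p$ (the water-filling powers). Fix $m\in\{1,\dots,M\}$ with $s_m^\star>0$, and consider the $m$th pair of users, the near user UT $m$ and the far user UT $m'$, with power shares $\alpha_m,\alpha_{m'}>0$, $\alpha_m+\alpha_{m'}=1$,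 path losses $\eta_m,\eta_{m'}>0$ and target rates $\mathcal R^{\rm t}_{m},\mathcal R^{\rm t}_{m'}\ge 0$. Let $\mathbf H_m,\mathbf H_{m'}$ be independent random $N\times M$ matrices with i.i.d. $\mathcal{CN}(0,1)$ entries, and let the detection vectors $\mathbf v_m,\mathbf v_{m'}$ be arbitrary random vectors in $\mathbb C^N$ that satisfy the signal alignment equations $\mathbf H_m^{\mathsf H}\mathbf v_m=\mathbf u_m$ and $\mathbf H_{m'}^{\mathsf H}\mathbf v_{m'}=\mathbf u_m$ almost surely. Put $$\gamma_m=\frac{\alpha_m\eta_m^{-1}q_m|\mathbf v_m^{\mathsf H}\mathbf H_m\mathbf u_m|^2}{\|\mathbf v_m\|^2},\qquad \gamma_{m'}=\frac{\alpha_{m'}\eta_{m'}^{-1}q_m|\mathbf v_{m'}^{\mathsf H}\mathbf H_{m'}\mathbf u_m|^2}{\alpha_m\eta_{m'}^{-1}q_m|\mathbf v_{m'}^{\mathsf H}\mathbf H_{m'}\mathbf u_m|^2+\|\mathbf v_{m'}\|^2},$$ and define the outage probabilities $$\mathcal P_m=1-\Pr\big(\log_2(1+\gamma_m)>\mathcal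 R^{\rm t}_m,\ \log_2(1+\gamma_{m'})>\mathcal R^{\rm t}_{m'}\big),\qquad \mathcal P_{m'}=\Pr\big(\log_2(1+\gamma_{m'})<\mathcal R^{\rm t}_{m'}\big)$$ and the thresholds $$\varrho_m=\frac{2^{\mathcal R^{\rm t}_m}-1}{\alpha_m\eta_m^{-1}},\qquad \varrho_{m'}=\frac{2^{\mathcal R^{\rm t}_{m'}}-1}{\eta_{m'}^{-1}-2^{\mathcal R^{\rm t}_{m'}}\alpha_m\eta_{m'}^{-1}}$$ (with $\varrho_{m'}:=0$ if the last denominator vanishes). Let $F_\lambda$ be the cumulative distribution function of the largest eigenvalue of the complex Wishart matrix $\mathbf H\mathbf H^{\mathsf H}$, where $\mathbf H$ is $N\times M$ with i.i.d. $\mathcal{CN}(0,1)$ entries. Then $$\mathcal P_m\ \ge\ F_\lambda\!\left(\tfrac{\varrho_m}{s_m^\star}\right)+F_\lambda\!\left(\tfrac{\varrho_{m'}}{s_m^\star}\right)-F_\lambda\!\left(\tfrac{\varrho_m}{s_m^\star}\right)F_\lambda\!\left(\tfrac{\varrho_{m'}}{s_m^\star}\right),\qquad \mathcal P_{m'}\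 \ge\ F_\lambda\!\left(\tfrac{\varrho_{m'}}{s_m^\star}\right).$$ If moreover $N=M$ and $2^{\mathcal R^{\rm t}_{m'}}\alpha_m<1$, then $$\mathcal P_m=1-\exp\!\left(-\frac{\varrho_m+\varrho_{m'}}{s_m^\star}\right),\qquad \mathcal P_{m'}=1-\exp\!\left(-\frac{\varrho_{m'}}{s_m^\star}\right).$$ -/

import Mathlib

open MeasureTheory ProbabilityTheory
open scoped Matrix ComplexOrder

noncomputable section

namespace NomaIsac

/-! ### Complex Gaussian channels and the largest Wishart eigenvalue -/

/-- The standard circularly symmetric complex Gaussian law `CN(0,1)`: independent real and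
imaginary parts, each a centred real Gaussian of variance `1/2`. -/
def stdComplexGaussian : Measure ℂ :=
  ((gaussianReal 0 (1 / 2)).prod (gaussianReal 0 (1 / 2))).map
    (fun z : ℝ × ℝ => (⟨z.1, z.2⟩ : ℂ))

/-- The largest eigenvalue of the Hermitian matrix `H Hᴴ`. -/
def maxEigenvalue {N M : ℕ} (H : Matrix (Fin N) (Fin M) ℂ) : ℝ :=
  ⨆ i, (Matrix.isHermitian_mul_conjTranspose_self H).eigenvalues i

/-- The cumulative distribution function of the largest eigenvalue of the complex Wishart matrix
`H Hᴴ`, where `H` is `N × M` with i.i.d. `CN(0,1)` entries. -/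
def wishartMaxCDF (N M : ℕ) (x : ℝ) : ℝ :=
  (Measure.pi (fun _ : Fin N × Fin M => stdComplexGaussian)).real
    {g | maxEigenvalue (Matrix.of fun i j => g (i, j)) ≤ x}

/-- Rayleigh fading channels `H`, `H'` of the two users of a pair: all `2NM` entries are
independent and each has law `CN(0,1)`. -/
structure IsRayleighPair {Ω : Type*} [MeasurableSpace Ω] (P : Measure Ω) {N M : ℕ}
    (H H' : Ω → Matrix (Fin N) (Fin M) ℂ) : Prop where
  law : ∀ i j, HasLaw (fun ω => H ω i j) stdComplexGaussian P
  law' : ∀ i j, HasLaw (fun ω => H' ω i j) stdComplexGaussian P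
  indep : iIndepFun
    (fun (k : (Fin N × Fin M) ⊕ (Fin N × Fin M)) (ω : Ω) =>
      Sum.elim (fun a => H ω a.1 a.2) (fun a => H' ω a.1 a.2) k) P

/-! ### The sensing-centric design -/

/-- The precoding matrix `W Ξ^{1/2}` with normalized precoders the columns of `W` and power
allocation `Ξ = diag(q₁, …, q_M)`. -/
def precoder {M : ℕ} (W : Matrix (Fin M) (Fin M) ℂ) (q : Fin M → ℝ) :
    Matrix (Fin M) (Fin M) ℂ :=
  W * Matrix.diagonal (fun i => ((Real.sqrt (q i) : ℝ) : ℂ))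

/-- The downlink sensing rate `(M / L) log₂ det (I + L Pᴴ R P)` of a precoding matrix `P`
(the determinant is a positive real when `R` is positive semidefinite). -/
def sensingRate {M : ℕ} (L : ℕ) (R P : Matrix (Fin M) (Fin M) ℂ) : ℝ :=
  (M : ℝ) / L * Real.logb 2 (1 + (L : ℂ) • (Pᴴ * R * P)).det.re

/-- The sensing-centric design for frame length `L`, correlation matrix `R` and power budget `p`:
the normalized precoder is the unitary matrix `U` of an eigendecomposition
`R = U diag(lam) Uᴴ`, and the powers `q` are such that the precoding matrix `U diag(q)^{1/2}`
maximizes the sensing rate among all precoding matrices within the power budget. -/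
structure IsSensingCentric {M : ℕ} (L : ℕ) (p : ℝ) (R U : Matrix (Fin M) (Fin M) ℂ)
    (lam q : Fin M → ℝ) : Prop where
  unitary : U ∈ Matrix.unitaryGroup (Fin M) ℂ
  eigendecomposition : R = U * Matrix.diagonal (fun i => (lam i : ℂ)) * Uᴴ
  power_nonneg : ∀ i, 0 ≤ q i
  budget : (precoder U q * (precoder U q)ᴴ).trace.re ≤ p
  maximal : ∀ P : Matrix (Fin M) (Fin M) ℂ, (P * Pᴴ).trace.re ≤ p →
    sensingRate L R P ≤ sensingRate L R (precoder U q)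

/-- The water-filling power of the `m`-th eigendirection at water level `1 / ν`. -/
def waterFilling {M : ℕ} (L : ℕ) (lam : Fin M → ℝ) (ν : ℝ) (m : Fin M) : ℝ :=
  max 0 (1 / ν - 1 / (L * lam m))

/-! ### Rates and outage probabilities -/

/-- The squared magnitude `|vᴴ H w|²` of the effective scalar channel. -/
def effectiveGain {N M : ℕ} (H : Matrix (Fin N) (Fin M) ℂ) (v : Fin N → ℂ) (w : Fin M → ℂ) : ℝ :=
  ‖star v ⬝ᵥ (H *ᵥ w)‖ ^ 2

/-- The squared Euclidean norm of a detection vector. -/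
def normSq {N : ℕ} (v : Fin N → ℂ) : ℝ := ‖WithLp.toLp 2 v‖ ^ 2

/-- SNR of the near user after successive interference cancellation: power share `α`, path loss
`η`, transmit power `q`, channel `H`, detection vector `v`, precoding vector `w`. -/
def snrNear {N M : ℕ} (α η q : ℝ) (H : Matrix (Fin N) (Fin M) ℂ) (v : Fin N → ℂ)
    (w : Fin M → ℂ) : ℝ :=
  α * η⁻¹ * q * effectiveGain H v w / normSq v

/-- SINR of the far user, with own power share `α'`, path loss `η'`, and the near user's
share `α` acting as interference. -/
def sinrFar {N M : ℕ} (α α' η' q : ℝ) (H : Matrix (Fin N) (Fin M) ℂ) (v : Fin N → ℂ)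
    (w : Fin M → ℂ) : ℝ :=
  α' * η'⁻¹ * q * effectiveGain H v w / (α * η'⁻¹ * q * effectiveGain H v w + normSq v)

/-- The communication rate, in bits, at signal-to-noise ratio `γ`. -/
def commRate (γ : ℝ) : ℝ := Real.logb 2 (1 + γ)

/-- Outage probability of the near user: it must support both target rates `t`, `t'`. -/
def outageNear {Ω : Type*} [MeasurableSpace Ω] (P : Measure Ω) (rate rate' : Ω → ℝ)
    (t t' : ℝ) : ℝ :=
  1 - P.real {ω | t < rate ω ∧ t' < rate' ω}

/-- Outage probability of the far user. -/
def outageFar {Ω : Type*} [MeasurableSpace Ω] (P : Measure Ω) (rate' : Ω → ℝ) (t' : ℝ) : ℝ :=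
  P.real {ω | rate' ω < t'}

/-- The threshold of the near user. -/
def thresholdNear (α η t : ℝ) : ℝ := ((2 : ℝ) ^ t - 1) / (α * η⁻¹)

/-- The threshold of the far user. -/
def thresholdFar (α η' t' : ℝ) : ℝ := ((2 : ℝ) ^ t' - 1) / (η'⁻¹ - (2 : ℝ) ^ t' * α * η'⁻¹)

end NomaIsac

end

namespace NomaIsac

/-! ### The standard complex Gaussian law -/

/-! Alignment removes the channel from the numerator of both ratios: if `Hᴴ v = u` with `u` a unit
vector, then `vᴴ H u = uᴴ u = 1`. Each rate event therefore becomes a comparison of the gain `1 /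
‖v‖²` with a threshold divided by the allotted power. That power is the water-filling one: for
precoders `U diag(q)^{1/2}` the sensing rate is a sum of strictly concave functions of the powers,
and a tangent-line argument (`eq_of_sum_log_le`) forces `q m = s`.

For the lower bounds, `1 = ‖Hᴴ v‖² ≤ λ_max(H Hᴴ) ‖v‖²`, so the gain never exceeds the largest
Wishart eigenvalue, whatever solution `v` is chosen. Independence of the channels turns the joint
bound into a product. The far user's outage is a strict event while the distribution function uses
`≤`, so one also needs that the largest eigenvalue has no atoms.

For `N = M` the channel is almost surely invertible and `v = H⁻ᴴ u` is forced. Right unitary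
invariance replaces `u` by a basis vector `e_m`. Then the gain is the squared length of the `m`th
column of the channel along a unit vector orthogonal to the other columns. Given those columns this
is the squared modulus of a `CN(0,1)` variable, hence exponential of rate one.

If `2 ^ t' * α ≥ 1`, the far user is almost surely in outage, both outage probabilities are one, and
the bounds hold because distribution functions are at most one. -/

instance isProbabilityMeasure_stdComplexGaussian : IsProbabilityMeasure stdComplexGaussian :=
  Measure.isProbabilityMeasure_map Complex.measurableEquivRealProd.symm.measurable.aemeasurable

lemma gaussianPDF_half_mul (x y : ℝ) :
    gaussianPDF 0 (1 / 2) x * gaussianPDF 0 (1 / 2) y =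
      ENNReal.ofReal (Real.pi⁻¹ * Real.exp (-(x ^ 2 + y ^ 2))) := by
  rw [gaussianPDF, gaussianPDF, ← ENNReal.ofReal_mul (gaussianPDFReal_nonneg _ _ _)]
  congr 1
  simp only [gaussianPDFReal, sub_zero]
  have h2 : 2 * Real.pi * ((1 / 2 : NNReal) : ℝ) = Real.pi := by push_cast; ring
  have h3 : 2 * ((1 / 2 : NNReal) : ℝ) = 1 := by push_cast; ring
  rw [h2, h3, div_one, div_one, mul_mul_mul_comm, ← Real.exp_add, ← mul_inv,
    Real.mul_self_sqrt Real.pi_pos.le]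
  ring_nf

lemma stdComplexGaussian_eq_withDensity :
    stdComplexGaussian = volume.withDensity
      (fun z : ℂ => ENNReal.ofReal (Real.pi⁻¹ * Real.exp (-‖z‖ ^ 2))) := by
  have hv : (1 / 2 : NNReal) ≠ 0 := by norm_num
  ext s hs
  have he := Complex.volume_preserving_equiv_real_prod.symm
  change (Measure.map Complex.measurableEquivRealProd.symm _) s = _
  rw [Measure.map_apply Complex.measurableEquivRealProd.symm.measurable hs,
    gaussianReal_of_var_ne_zero _ hv, prod_withDensity (by fun_prop) (by fun_prop),
    withDensity_apply _ hs,
    withDensity_apply _ (Complex.measurableEquivRealProd.symm.measurable hs),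
    ← he.setLIntegral_comp_preimage_emb Complex.measurableEquivRealProd.symm.measurableEmbedding]
  refine lintegral_congr fun z => ?_
  rw [gaussianPDF_half_mul, Complex.sq_norm, Complex.normSq_apply]
  simp [sq]

lemma stdComplexGaussian_absolutelyContinuous : stdComplexGaussian ≪ volume := by
  rw [stdComplexGaussian_eq_withDensity]
  exact withDensity_absolutelyContinuous _ _

/-- The squared modulus of a `CN(0,1)` variable is exponential of rate one: strict tail. -/
lemma stdComplexGaussian_lt_normSq {c : ℝ} (hc : 0 ≤ c) :
    stdComplexGaussian {z | c < ‖z‖ ^ 2} = ENNReal.ofReal (Real.exp (-c)) := by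
  have hm : MeasurableSet {z : ℂ | c < ‖z‖ ^ 2} :=
    measurableSet_lt measurable_const (by fun_prop)
  rw [stdComplexGaussian_eq_withDensity, withDensity_apply _ hm, ← lintegral_indicator hm,
    ← Complex.lintegral_comp_polarCoord_symm]
  -- The density is radial, so in polar coordinates the integrand is a function of the radius times
  -- the constant 1 in the angle.
  have h1 : ∀ p ∈ polarCoord.target,
      ENNReal.ofReal p.1 • ({z : ℂ | c < ‖z‖ ^ 2}.indicator
        (fun z : ℂ => ENNReal.ofReal (Real.pi⁻¹ * Real.exp (-‖z‖ ^ 2)))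
          (Complex.polarCoord.symm p)) =
      (Set.Ioi (Real.sqrt c)).indicator
        (fun r => ENNReal.ofReal (r * (Real.pi⁻¹ * Real.exp (-r ^ 2)))) p.1 *
      (fun _ : ℝ => (1 : ENNReal)) p.2 := by
    rintro ⟨r, θ⟩ hp
    rw [polarCoord_target, Set.mem_prod] at hp
    have hr : 0 < r := hp.1
    have hn := Complex.norm_polarCoord_symm (r, θ)
    simp only [Set.indicator_apply, Set.mem_ofPred_eq, hn, sq_abs, Set.mem_Ioi, mul_one,
      Real.sqrt_lt' hr]
    split_ifs
    · rw [smul_eq_mul, ← ENNReal.ofReal_mul hr.le]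
    · simp
  have hmt : MeasurableSet polarCoord.target := polarCoord.open_target.measurableSet
  rw [setLIntegral_congr_fun hmt h1, polarCoord_target, Measure.volume_eq_prod,
    ← Measure.prod_restrict, lintegral_prod_mul (g := fun _ : ℝ => (1 : ENNReal))
      ((Measurable.indicator (by fun_prop) measurableSet_Ioi).aemeasurable) (by fun_prop)]
  have h2 : ∫⁻ _ in Set.Ioo (-Real.pi) Real.pi, (1 : ENNReal) = ENNReal.ofReal (2 * Real.pi) := by
    rw [setLIntegral_one, Real.volume_Ioo]
    ring_nf
  have hsub : Set.Ioi (Real.sqrt c) ∩ Set.Ioi (0 : ℝ) = Set.Ioi (Real.sqrt c) :=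
    Set.inter_eq_left.2 (Set.Ioi_subset_Ioi (Real.sqrt_nonneg c))
  -- Radial antiderivative; its factor `(2π)⁻¹` cancels against the angular integral `2π`.
  have hd : ∀ x ∈ Set.Ioi (Real.sqrt c), HasDerivAt
      (fun r => -((2 * Real.pi)⁻¹ * Real.exp (-r ^ 2))) (x * (Real.pi⁻¹ * Real.exp (-x ^ 2))) x := by
    intro x _
    have := (((hasDerivAt_pow 2 x).neg.exp).const_mul (2 * Real.pi)⁻¹).neg
    convert! this using 1
    simp
    field_simp
  have hpos : ∀ x ∈ Set.Ioi (Real.sqrt c), 0 ≤ x * (Real.pi⁻¹ * Real.exp (-x ^ 2)) := by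
    intro x hx
    have : 0 ≤ x := (Real.sqrt_nonneg c).trans (le_of_lt hx)
    have := Real.pi_pos
    positivity
  have ht : Filter.Tendsto (fun r : ℝ => -((2 * Real.pi)⁻¹ * Real.exp (-r ^ 2)))
      Filter.atTop (nhds 0) := by
    have h := Real.tendsto_exp_neg_atTop_nhds_zero.comp
      (Filter.tendsto_pow_atTop (α := ℝ) two_ne_zero)
    simpa using (h.const_mul (2 * Real.pi)⁻¹).neg
  have hcont : ContinuousWithinAt (fun r : ℝ => -((2 * Real.pi)⁻¹ * Real.exp (-r ^ 2)))
      (Set.Ici (Real.sqrt c)) (Real.sqrt c) := by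
    apply Continuous.continuousWithinAt; fun_prop
  rw [h2, lintegral_indicator measurableSet_Ioi, Measure.restrict_restrict measurableSet_Ioi, hsub,
    ← ofReal_integral_eq_lintegral_ofReal
      (integrableOn_Ioi_deriv_of_nonneg hcont hd hpos ht)
      ((ae_restrict_iff' measurableSet_Ioi).2 (ae_of_all _ hpos)),
    integral_Ioi_of_hasDerivAt_of_nonneg hcont hd hpos ht, Real.sq_sqrt hc,
    ← ENNReal.ofReal_mul (by have := Real.pi_pos; simp; positivity)]
  congr 1
  have := Real.pi_pos
  field_simp
  ring

/-- The squared modulus of a `CN(0,1)` variable is exponential of rate one: weak tail. -/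
lemma stdComplexGaussian_le_normSq {c : ℝ} (hc : 0 ≤ c) :
    stdComplexGaussian {z | c ≤ ‖z‖ ^ 2} = ENNReal.ofReal (Real.exp (-c)) := by
  rw [← stdComplexGaussian_lt_normSq hc]
  have h0 : volume {z : ℂ | ‖z‖ ^ 2 = c} = 0 := by
    refine measure_mono_null (t := Metric.sphere (0 : ℂ) (Real.sqrt c)) (fun z hz => ?_)
      (Measure.addHaar_sphere _ _ _)
    simp only [Set.mem_ofPred_eq] at hz
    rw [mem_sphere_zero_iff_norm, ← hz, Real.sqrt_sq (norm_nonneg z)]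
  have h1 : {z : ℂ | c ≤ ‖z‖ ^ 2} = {z | c < ‖z‖ ^ 2} ∪ {z | ‖z‖ ^ 2 = c} := by
    ext z; simp [le_iff_lt_or_eq, eq_comm]
  rw [h1]
  exact measure_congr (union_ae_eq_left_of_ae_eq_empty
    (ae_eq_empty.2 (stdComplexGaussian_absolutelyContinuous h0)))

/-! ### Characteristic functions, product laws and unitary invariance -/

lemma charFun_stdComplexGaussian (t : ℂ) :
    charFun stdComplexGaussian t = Complex.exp (-(‖t‖ : ℂ) ^ 2 / 4) := by
  have hm : Measurable fun z : ℝ × ℝ => (⟨z.1, z.2⟩ : ℂ) :=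
    Complex.measurableEquivRealProd.symm.measurable
  rw [charFun_apply, stdComplexGaussian, integral_map hm.aemeasurable (by fun_prop)]
  have h : ∀ z : ℝ × ℝ, Complex.exp ((inner ℝ (⟨z.1, z.2⟩ : ℂ) t : ℝ) * Complex.I) =
      Complex.exp ((inner ℝ z.1 t.re : ℝ) * Complex.I) *
        Complex.exp ((inner ℝ z.2 t.im : ℝ) * Complex.I) := by
    intro z
    rw [← Complex.exp_add, ← add_mul, ← Complex.ofReal_add]
    congr 4
    simp [Complex.inner]
  simp_rw [h]
  rw [integral_prod_mul (fun x : ℝ => Complex.exp ((inner ℝ x t.re : ℝ) * Complex.I))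
    (fun x : ℝ => Complex.exp ((inner ℝ x t.im : ℝ) * Complex.I)), ← charFun_apply,
    ← charFun_apply, charFun_gaussianReal, charFun_gaussianReal, ← Complex.exp_add]
  congr 1
  rw [← Complex.ofReal_pow ‖t‖, Complex.sq_norm, Complex.normSq_apply]
  push_cast
  ring

/-- A finite product of measures is absolutely continuous if each factor is. -/
lemma pi_absolutelyContinuous {ι : Type*} [Fintype ι] {X : Type*} [MeasurableSpace X]
    {μ ν : Measure X} [SigmaFinite μ] [SigmaFinite ν] (h : μ ≪ ν) :
    Measure.pi (fun _ : ι => μ) ≪ Measure.pi (fun _ : ι => ν) := by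
  refine Fintype.induction_empty_option
    (P := fun ι _ => Measure.pi (fun _ : ι => μ) ≪ Measure.pi (fun _ : ι => ν)) ?_ ?_ ?_ ι
  · intro α β _ e ih
    let _ : Fintype α := Fintype.ofEquiv β e.symm
    have h1 := (measurePreserving_piCongrLeft (fun _ : β => μ) e).map_eq
    have h2 := (measurePreserving_piCongrLeft (fun _ : β => ν) e).map_eq
    rw [← h1, ← h2]
    convert ih.map (MeasurableEquiv.measurable _)
  · rw [Measure.pi_of_empty, Measure.pi_of_empty]
  · intro α _ ih
    rw [← Measure.pi_map_piOptionEquivProd, ← Measure.pi_map_piOptionEquivProd]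
    exact (ih.prod h).map (MeasurableEquiv.measurable _)

lemma pi_stdComplexGaussian_absolutelyContinuous (ι : Type*) [Fintype ι] :
    Measure.pi (fun _ : ι => stdComplexGaussian) ≪ volume :=
  pi_absolutelyContinuous stdComplexGaussian_absolutelyContinuous

lemma inner_toLp_eq_re_dotProduct {ι : Type*} [Fintype ι] (x y : ι → ℂ) :
    inner ℝ (WithLp.toLp 2 x : EuclideanSpace ℂ ι) (WithLp.toLp 2 y) = (star x ⬝ᵥ y).re := by
  simp [PiLp.inner_apply, Complex.inner, dotProduct, mul_comm]

lemma normSq_eq_re_dotProduct {ι : Type*} [Fintype ι] (x : ι → ℂ) :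
    ‖(WithLp.toLp 2 x : EuclideanSpace ℂ ι)‖ ^ 2 = (star x ⬝ᵥ x).re := by
  rw [← inner_toLp_eq_re_dotProduct, real_inner_self_eq_norm_sq]

/-- The dependence on `t` through `‖t‖` alone is the source of unitary invariance. -/
lemma charFun_pi_stdComplexGaussian {ι : Type*} [Fintype ι] (t : EuclideanSpace ℂ ι) :
    charFun ((Measure.pi (fun _ : ι => stdComplexGaussian)).map (WithLp.toLp 2)) t =
      Complex.exp (-(‖t‖ : ℂ) ^ 2 / 4) := by
  rw [charFun_pi]
  simp_rw [charFun_stdComplexGaussian]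
  rw [← Complex.exp_sum, ← Finset.sum_div, Finset.sum_neg_distrib, ← Complex.ofReal_pow,
    EuclideanSpace.norm_sq_eq]
  push_cast
  rfl

/-- Invariance of i.i.d. complex Gaussian vectors under co-isometries. -/
lemma map_mulVec_pi_stdComplexGaussian {ι κ : Type*} [Fintype ι] [Fintype κ] [DecidableEq κ]
    (B : Matrix κ ι ℂ) (hB : B * Bᴴ = 1) :
    (Measure.pi (fun _ : ι => stdComplexGaussian)).map (fun x => B *ᵥ x) =
      Measure.pi (fun _ : κ => stdComplexGaussian) := by
  have hBm : Measurable fun x : ι → ℂ => B *ᵥ x := by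
    apply Continuous.measurable; fun_prop
  have hL : Measurable (WithLp.toLp 2 : (κ → ℂ) → EuclideanSpace ℂ κ) := by fun_prop
  have key : ((Measure.pi (fun _ : ι => stdComplexGaussian)).map (fun x => B *ᵥ x)).map
      (WithLp.toLp 2 : (κ → ℂ) → EuclideanSpace ℂ κ) =
      (Measure.pi (fun _ : κ => stdComplexGaussian)).map (WithLp.toLp 2) := by
    have i1 : IsProbabilityMeasure ((Measure.pi (fun _ : ι => stdComplexGaussian)).map
      (fun x => B *ᵥ x)) := Measure.isProbabilityMeasure_map hBm.aemeasurable
    have i2 := Measure.isProbabilityMeasure_map (μ := (Measure.pi (fun _ : ι =>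
      stdComplexGaussian)).map (fun x => B *ᵥ x)) hL.aemeasurable
    have i3 := Measure.isProbabilityMeasure_map (μ := Measure.pi (fun _ : κ =>
      stdComplexGaussian)) hL.aemeasurable
    apply Measure.ext_of_charFun (E := EuclideanSpace ℂ κ)
    ext t
    rw [charFun_pi_stdComplexGaussian]
    -- `B Bᴴ = 1` makes `Bᴴ` an isometry, so moving `B` to the other side of the inner product
    -- leaves the radial characteristic function unchanged.
    have ht : ‖t‖ ^ 2 = ‖(WithLp.toLp 2 (Bᴴ *ᵥ t.ofLp) : EuclideanSpace ℂ ι)‖ ^ 2 := by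
      conv_lhs => rw [← WithLp.toLp_ofLp 2 t]
      rw [normSq_eq_re_dotProduct, normSq_eq_re_dotProduct, Matrix.star_mulVec,
        Matrix.conjTranspose_conjTranspose, ← Matrix.dotProduct_mulVec, Matrix.mulVec_mulVec, hB,
        Matrix.one_mulVec]
    rw [← Complex.ofReal_pow, ht, Complex.ofReal_pow, ← charFun_pi_stdComplexGaussian,
      Measure.map_map hL hBm, charFun_apply, charFun_apply, integral_map (hL.comp hBm).aemeasurable (by fun_prop),
      integral_map (by fun_prop) (by fun_prop)]
    refine integral_congr_ae (ae_of_all _ fun x => ?_)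
    simp only [Function.comp_apply]
    conv_lhs => rw [← WithLp.toLp_ofLp 2 t]
    rw [inner_toLp_eq_re_dotProduct, inner_toLp_eq_re_dotProduct, Matrix.star_mulVec,
      Matrix.dotProduct_mulVec]
  have e := congrArg (Measure.map (WithLp.ofLp : EuclideanSpace ℂ κ → (κ → ℂ))) key
  have hO : Measurable (WithLp.ofLp : EuclideanSpace ℂ κ → (κ → ℂ)) := by fun_prop
  rw [Measure.map_map hO hL, Measure.map_map hO hL] at e
  simpa [Function.comp_def] using e

/-! ### The largest eigenvalue of `H Hᴴ` -/

lemma normSq_eq_re {N : ℕ} (x : Fin N → ℂ) : normSq x = (star x ⬝ᵥ x).re :=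
  normSq_eq_re_dotProduct x

lemma normSq_eq_sum {N : ℕ} (x : Fin N → ℂ) : normSq x = ∑ i, ‖x i‖ ^ 2 := by
  rw [normSq, EuclideanSpace.norm_sq_eq]

lemma normSq_smul {N : ℕ} (a : ℂ) (x : Fin N → ℂ) : normSq (a • x) = ‖a‖ ^ 2 * normSq x := by
  simp [normSq_eq_sum, mul_pow, Finset.mul_sum]

lemma continuous_normSq {N : ℕ} : Continuous (normSq : (Fin N → ℂ) → ℝ) := by
  simp only [funext normSq_eq_sum]; fun_prop

lemma normSq_pos {N : ℕ} {x : Fin N → ℂ} (hx : x ≠ 0) : 0 < normSq x := by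
  rw [normSq]
  have : (WithLp.toLp 2 x : EuclideanSpace ℂ (Fin N)) ≠ 0 := by simpa using hx
  positivity

lemma normSq_conjTranspose_mulVec {N M : ℕ} (H : Matrix (Fin N) (Fin M) ℂ) (v : Fin N → ℂ) :
    normSq (Hᴴ *ᵥ v) = (star v ⬝ᵥ ((H * Hᴴ) *ᵥ v)).re := by
  rw [normSq_eq_re, Matrix.star_mulVec, Matrix.conjTranspose_conjTranspose,
    ← Matrix.dotProduct_mulVec, Matrix.mulVec_mulVec]

lemma normSq_mulVec_of_isometry {N : ℕ} {W : Matrix (Fin N) (Fin N) ℂ} (hW : Wᴴ * W = 1)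
    (v : Fin N → ℂ) : normSq (W *ᵥ v) = normSq v := by
  rw [normSq_eq_re, Matrix.star_mulVec, ← Matrix.dotProduct_mulVec, Matrix.mulVec_mulVec, hW,
    Matrix.one_mulVec, normSq_eq_re]

lemma re_dotProduct_mulVec_eq_sum_eigenvalues {N : ℕ} {A : Matrix (Fin N) (Fin N) ℂ}
    (hA : A.IsHermitian) (v : Fin N → ℂ) :
    (star v ⬝ᵥ (A *ᵥ v)).re =
      ∑ i, hA.eigenvalues i *
        ‖((hA.eigenvectorUnitary : Matrix (Fin N) (Fin N) ℂ)ᴴ *ᵥ v) i‖ ^ 2 := by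
  obtain ⟨W, hW⟩ : ∃ W : Matrix (Fin N) (Fin N) ℂ, W = hA.eigenvectorUnitary := ⟨_, rfl⟩
  rw [← hW]
  have h : A = W * Matrix.diagonal (RCLike.ofReal ∘ hA.eigenvalues) * Wᴴ := by
    conv_lhs => rw [hA.spectral_theorem, Unitary.conjStarAlgAut_apply]
    rw [hW]
    rfl
  set y := Wᴴ *ᵥ v with hy
  have h1 : star v ⬝ᵥ (A *ᵥ v) =
      star y ⬝ᵥ (Matrix.diagonal (RCLike.ofReal ∘ hA.eigenvalues) *ᵥ y) := by
    conv_lhs => rw [h]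
    rw [hy, Matrix.star_mulVec, Matrix.conjTranspose_conjTranspose, ← Matrix.dotProduct_mulVec,
      Matrix.mulVec_mulVec, Matrix.mulVec_mulVec, Matrix.mul_assoc]
  rw [h1, dotProduct, Complex.re_sum]
  refine Finset.sum_congr rfl fun i _ => ?_
  rw [Matrix.mulVec_diagonal, Complex.sq_norm, Complex.normSq_apply]
  simp
  ring

/-- Rayleigh quotient characterization, by diagonalizing `H Hᴴ`. It gives measurability and scaling
of the largest eigenvalue without handling eigenvalues individually. Positivity of `N` excludes an
empty supremum, which has the default value 0. -/
lemma maxEigenvalue_le_iff {N M : ℕ} (hN : 0 < N) (H : Matrix (Fin N) (Fin M) ℂ) (x : ℝ) :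
    maxEigenvalue H ≤ x ↔ ∀ v, normSq (Hᴴ *ᵥ v) ≤ x * normSq v := by
  have : Nonempty (Fin N) := ⟨⟨0, hN⟩⟩
  set hA := Matrix.isHermitian_mul_conjTranspose_self H with hAdef
  rw [maxEigenvalue, ciSup_le_iff (Set.finite_range _).bddAbove]
  constructor
  · intro h v
    have hW : ((hA.eigenvectorUnitary : Matrix (Fin N) (Fin N) ℂ)ᴴ)ᴴ *
        (hA.eigenvectorUnitary : Matrix (Fin N) (Fin N) ℂ)ᴴ = 1 := by
      rw [Matrix.conjTranspose_conjTranspose]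
      exact Matrix.mem_unitaryGroup_iff.1 hA.eigenvectorUnitary.2
    rw [normSq_conjTranspose_mulVec, re_dotProduct_mulVec_eq_sum_eigenvalues hA,
      ← normSq_mulVec_of_isometry hW v, normSq_eq_sum, Finset.mul_sum]
    exact Finset.sum_le_sum fun i _ => mul_le_mul_of_nonneg_right (h i) (sq_nonneg _)
  · intro h i
    have hb : normSq (hA.eigenvectorBasis i).ofLp = 1 := by
      rw [normSq, WithLp.toLp_ofLp, hA.eigenvectorBasis.norm_eq_one, one_pow]
    have := h (hA.eigenvectorBasis i).ofLp
    rw [normSq_conjTranspose_mulVec, hb, mul_one] at this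
    rw [hA.eigenvalues_eq]
    exact this

lemma normSq_conjTranspose_mulVec_le {N M : ℕ} (hN : 0 < N) (H : Matrix (Fin N) (Fin M) ℂ)
    (v : Fin N → ℂ) : normSq (Hᴴ *ᵥ v) ≤ maxEigenvalue H * normSq v :=
  (maxEigenvalue_le_iff hN H _).1 le_rfl v

lemma measurable_maxEigenvalue {N M : ℕ} (hN : 0 < N) :
    Measurable fun g : Fin N × Fin M → ℂ => maxEigenvalue (Matrix.of fun i j => g (i, j)) := by
  refine measurable_of_Iic fun x => IsClosed.measurableSet ?_
  -- Each sublevel set is an intersection of closed conditions, one per test vector, hence closed.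
  have : (fun g : Fin N × Fin M → ℂ => maxEigenvalue (Matrix.of fun i j => g (i, j))) ⁻¹'
      Set.Iic x = ⋂ v : Fin N → ℂ, {g | normSq ((Matrix.of fun i j => g (i, j))ᴴ *ᵥ v) ≤
        x * normSq v} := by
    ext g
    simp [maxEigenvalue_le_iff hN]
  rw [this]
  refine isClosed_iInter fun v => isClosed_le (continuous_normSq.comp ?_) continuous_const
  refine Continuous.matrix_mulVec (Continuous.matrix_conjTranspose ?_) continuous_const
  exact continuous_matrix fun i j => continuous_apply (i, j)

lemma maxEigenvalue_smul_le_iff {N M : ℕ} (hN : 0 < N) (H : Matrix (Fin N) (Fin M) ℂ) {r : ℝ}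
    (hr : 0 < r) (x : ℝ) :
    maxEigenvalue (r • H) ≤ r ^ 2 * x ↔ maxEigenvalue H ≤ x := by
  rw [maxEigenvalue_le_iff hN, maxEigenvalue_le_iff hN]
  refine forall_congr' fun v => ?_
  have : (r • H)ᴴ *ᵥ v = (r : ℂ) • (Hᴴ *ᵥ v) := by
    rw [Matrix.conjTranspose_smul, star_trivial, Matrix.smul_mulVec]
    ext i; simp
  rw [this, normSq_smul, Complex.norm_real, Real.norm_eq_abs, sq_abs, mul_assoc,
    mul_le_mul_iff_right₀ (by positivity)]

lemma maxEigenvalue_smul {N M : ℕ} (hN : 0 < N) (H : Matrix (Fin N) (Fin M) ℂ) {r : ℝ}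
    (hr : 0 < r) : maxEigenvalue (r • H) = r ^ 2 * maxEigenvalue H := by
  refine le_antisymm ((maxEigenvalue_smul_le_iff hN H hr _).2 le_rfl) ?_
  have h : r ^ 2 * (maxEigenvalue (r • H) / r ^ 2) = maxEigenvalue (r • H) := by field_simp
  have := (maxEigenvalue_smul_le_iff hN H hr (maxEigenvalue (r • H) / r ^ 2)).1 h.ge
  rwa [le_div_iff₀ (by positivity), mul_comm] at this

lemma eq_zero_of_maxEigenvalue_eq_zero {N M : ℕ} (hN : 0 < N) {H : Matrix (Fin N) (Fin M) ℂ}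
    (h : maxEigenvalue H = 0) : H = 0 := by
  have h1 := (maxEigenvalue_le_iff hN H 0).1 h.le
  have h2 : Hᴴ = 0 := by
    refine Matrix.ext_of_mulVec_single fun i => ?_
    by_contra hne
    rw [Matrix.zero_mulVec] at hne
    have := normSq_pos hne
    have := h1 (Pi.single i 1)
    linarith
  simpa using h2

open scoped Pointwise in
/-- The level sets of a positively homogeneous function, other than the zero level, are null. -/
lemma volume_level_set_eq_zero_of_homogeneous {E : Type*} [NormedAddCommGroup E]
    [NormedSpace ℝ E] [MeasurableSpace E] [BorelSpace E] [FiniteDimensional ℝ E] (μ : Measure E)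
    [μ.IsAddHaarMeasure] {f : E → ℝ} (hf : Measurable f)
    (hom : ∀ r : ℝ, 0 < r → ∀ x, f (r • x) = r ^ 2 * f x) {c : ℝ} (hc : c ≠ 0) :
    μ {x | f x = c} = 0 := by
  by_contra hne
  have hcount := Measure.countable_meas_level_set_pos (μ := μ) hf
  -- Dilating a level set of positive measure by `r` gives the level set at `r ^ 2 * c`, again of
  -- positive measure. This would produce uncountably many such levels, but there can be only
  -- countably many.
  have hsub : (fun r : ℝ => r ^ 2 * c) '' Set.Ioi 0 ⊆ {t | 0 < μ {a | f a = t}} := by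
    rintro _ ⟨r, hr, rfl⟩
    have hr0 : 0 < r := hr
    have : {a | f a = r ^ 2 * c} = r • {x | f x = c} := by
      ext a
      rw [Set.mem_smul_set_iff_inv_smul_mem₀ hr0.ne']
      simp only [Set.mem_ofPred_eq]
      rw [hom _ (by positivity)]
      constructor
      · intro h; rw [h]; field_simp
      · intro h; rw [← h]; field_simp
    simp only [Set.mem_ofPred_eq]
    rw [this, Measure.addHaar_smul]
    refine ENNReal.mul_pos ?_ hne
    simp [hr0.ne']
  have hinj : Set.InjOn (fun r : ℝ => r ^ 2 * c) (Set.Ioi 0) := by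
    intro a ha b hb hab
    have h2 : a ^ 2 = b ^ 2 := mul_right_cancel₀ hc hab
    exact (pow_left_inj₀ (le_of_lt ha) (le_of_lt hb) two_ne_zero).1 h2
  have h0 := (Set.countable_of_injective_of_countable_image hinj (hcount.mono hsub)).measure_zero
    (volume : Measure ℝ)
  simp [Real.volume_Ioi] at h0

/-- Nonzero levels are null by homogeneity; the zero level is the single point `H = 0`. -/
lemma pi_maxEigenvalue_eq_null {N M : ℕ} (hN : 0 < N) (hM : 0 < M) (c : ℝ) :
    Measure.pi (fun _ : Fin N × Fin M => stdComplexGaussian)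
      {g | maxEigenvalue (Matrix.of fun i j => g (i, j)) = c} = 0 := by
  apply pi_stdComplexGaussian_absolutelyContinuous
  have : Nonempty (Fin N × Fin M) := ⟨(⟨0, hN⟩, ⟨0, hM⟩)⟩
  rcases eq_or_ne c 0 with rfl | hc
  · refine measure_mono_null (t := {0}) (fun g hg => ?_) (measure_singleton _)
    have := eq_zero_of_maxEigenvalue_eq_zero hN hg
    ext ⟨i, j⟩
    exact congrFun (congrFun this i) j
  · exact volume_level_set_eq_zero_of_homogeneous volume (measurable_maxEigenvalue hN)
      (fun r hr x => maxEigenvalue_smul hN _ hr) hc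

/-! ### Square complex Gaussian matrices -/

/-- For fixed `A`, `det (A - z)` vanishes only at the finitely many eigenvalues `z`. By Fubini, for
some `z` the matrices with `det (A - z) = 0` form a null set, and translation by the scalar matrix
`z` carries this to `det A = 0`. -/
lemma volume_det_eq_zero (N : ℕ) :
    volume {g : Fin N × Fin N → ℂ | (Matrix.of fun i j => g (i, j)).det = 0} = 0 := by
  let A : (Fin N × Fin N → ℂ) → Matrix (Fin N) (Fin N) ℂ := fun g => Matrix.of fun i j => g (i, j)
  have hA : Continuous A := continuous_matrix fun i j => continuous_apply (i, j)
  let S : Set ((Fin N × Fin N → ℂ) × ℂ) := {p | (A p.1 - Matrix.scalar (Fin N) p.2).det = 0}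
  have hS : MeasurableSet S := by
    refine (isClosed_eq ?_ continuous_const).measurableSet
    refine Continuous.matrix_det ((hA.comp continuous_fst).sub ?_)
    refine continuous_matrix fun i j => ?_
    simp only [Matrix.scalar_apply, Matrix.diagonal_apply]
    split_ifs <;> fun_prop
  have h0 : (volume.prod volume) S = 0 := by
    rw [Measure.measure_prod_null hS]
    refine ae_of_all _ fun g => ?_
    refine Set.Finite.measure_zero ?_ _
    refine ((A g).charpoly.roots.toFinset.finite_toSet).subset fun z hz => ?_
    have hz' : (A g - Matrix.scalar (Fin N) z).det = 0 := hz
    rw [Finset.mem_coe, Multiset.mem_toFinset,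
      Polynomial.mem_roots (Matrix.charpoly_monic _).ne_zero, Polynomial.IsRoot.def,
      Matrix.eval_charpoly, ← neg_sub, Matrix.det_neg, hz', mul_zero]
  have h1 : ∀ᵐ z : ℂ, ∀ᵐ g : Fin N × Fin N → ℂ, (g, z) ∉ S := by
    have h2 : ∀ᵐ p ∂(volume : Measure ℂ).prod (volume : Measure (Fin N × Fin N → ℂ)),
        p.swap ∉ S :=
      (Measure.measurePreserving_swap (μ := (volume : Measure ℂ))
        (ν := (volume : Measure (Fin N × Fin N → ℂ)))).quasiMeasurePreserving.ae
          (measure_eq_zero_iff_ae_notMem.1 h0)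
    exact Measure.ae_ae_of_ae_prod h2
  obtain ⟨z, hz⟩ := h1.exists
  let c : Fin N × Fin N → ℂ := fun k => Matrix.scalar (Fin N) z k.1 k.2
  have hz' : volume ((fun g => g - c) ⁻¹' {g : Fin N × Fin N → ℂ | (A g).det = 0}) = 0 := by
    rw [measure_eq_zero_iff_ae_notMem]
    filter_upwards [hz] with g hg hdet
    exact hg hdet
  rwa [(measurePreserving_sub_right volume c).measure_preimage_emb
    (MeasurableEquiv.subRight c).measurableEmbedding] at hz'

lemma ae_det_ne_zero (N : ℕ) :
    ∀ᵐ g ∂Measure.pi (fun _ : Fin N × Fin N => stdComplexGaussian),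
      (Matrix.of fun i j => g (i, j)).det ≠ 0 :=
  measure_eq_zero_iff_ae_notMem.1
    (pi_stdComplexGaussian_absolutelyContinuous _ (volume_det_eq_zero N))

lemma exists_unit_orthogonal_columns {N : ℕ} (G : Matrix (Fin N) (Fin N) ℂ) (m : Fin N) :
    ∃ n : Fin N → ℂ, normSq n = 1 ∧ ∀ j, j ≠ m → star n ⬝ᵥ G.col j = 0 := by
  -- With column `m` zeroed the matrix is singular, and a kernel vector of its adjoint is orthogonal
  -- to all the other columns of `G`.
  have hdet : ((G.updateCol m 0)ᴴ).det = 0 := by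
    rw [Matrix.det_conjTranspose, Matrix.det_eq_zero_of_column_eq_zero m (by simp), star_zero]
  obtain ⟨w, hw0, hw⟩ := Matrix.exists_mulVec_eq_zero_iff.2 hdet
  have hpos := normSq_pos hw0
  refine ⟨(((Real.sqrt (normSq w))⁻¹ : ℝ) : ℂ) • w, ?_, fun j hj => ?_⟩
  · rw [normSq_smul, Complex.norm_real, Real.norm_eq_abs, sq_abs, inv_pow,
      Real.sq_sqrt hpos.le, inv_mul_cancel₀ hpos.ne']
  · have h := congrFun hw j
    have h2 : star w ⬝ᵥ G.col j = 0 := by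
      rw [← star_eq_zero, ← Matrix.star_dotProduct_star, star_star, dotProduct_comm]
      simpa [Matrix.mulVec, dotProduct, Matrix.conjTranspose_apply, Matrix.updateCol_ne hj,
        mul_comm] using h
    rw [star_smul, smul_dotProduct, h2, smul_zero]

/-- The zero-forcing gain is the squared length of the component of a column along the unit
vector orthogonal to all the other columns. -/
lemma inv_normSq_inv_conjTranspose_mulVec_single {N : ℕ} {G : Matrix (Fin N) (Fin N) ℂ}
    (hG : G.det ≠ 0) {m : Fin N} {n : Fin N → ℂ} (hn : normSq n = 1)
    (ho : ∀ j, j ≠ m → star n ⬝ᵥ G.col j = 0) :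
    (normSq (Gᴴ⁻¹ *ᵥ Pi.single m 1))⁻¹ = ‖star n ⬝ᵥ G.col m‖ ^ 2 := by
  have hu : IsUnit (Gᴴ).det := by
    rw [Matrix.det_conjTranspose]; exact (star_ne_zero.2 hG).isUnit
  have hcoord : ∀ j, (Gᴴ *ᵥ n) j = star (star n ⬝ᵥ G.col j) := by
    intro j
    rw [← Matrix.star_dotProduct_star, star_star, dotProduct_comm]
    simp [Matrix.mulVec, dotProduct, mul_comm]
  -- The entries of `Gᴴ n` are the conjugated projections of the columns on `n`; only the `m`th can
  -- survive.
  have h1 : Gᴴ *ᵥ n = star (star n ⬝ᵥ G.col m) • Pi.single m 1 := by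
    ext j
    rw [hcoord]
    rcases eq_or_ne j m with rfl | hj
    · simp
    · rw [ho j hj]; simp [hj]
  have h2 : n = star (star n ⬝ᵥ G.col m) • (Gᴴ⁻¹ *ᵥ Pi.single m 1) := by
    rw [← Matrix.mulVec_smul, ← h1, Matrix.mulVec_mulVec, Matrix.nonsing_inv_mul _ hu,
      Matrix.one_mulVec]
  have h3 := congrArg normSq h2
  rw [hn, normSq_smul, norm_star] at h3
  exact (eq_inv_of_mul_eq_one_left h3.symm).symm

lemma measurable_inv_conjTranspose_mulVec {N : ℕ} (u : Fin N → ℂ) :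
    Measurable fun g : Fin N × Fin N → ℂ => (Matrix.of fun i j => g (i, j))ᴴ⁻¹ *ᵥ u := by
  have hA : Continuous fun g : Fin N × Fin N → ℂ =>
      (Matrix.of fun i j => g (i, j) : Matrix (Fin N) (Fin N) ℂ)ᴴ :=
    Continuous.matrix_conjTranspose (continuous_matrix fun i j => continuous_apply (i, j))
  have h : (fun g : Fin N × Fin N → ℂ => (Matrix.of fun i j => g (i, j))ᴴ⁻¹ *ᵥ u) =
      fun g => ((Matrix.of fun i j => g (i, j) : Matrix (Fin N) (Fin N) ℂ)ᴴ.det)⁻¹ •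
        ((Matrix.of fun i j => g (i, j) : Matrix (Fin N) (Fin N) ℂ)ᴴ.adjugate *ᵥ u) := by
    ext1 g
    rw [Matrix.inv_def, Ring.inverse_eq_inv', Matrix.smul_mulVec]
  rw [h]
  exact (hA.matrix_det.measurable.inv).smul
    ((hA.matrix_adjugate.matrix_mulVec continuous_const).measurable)

/-- The modulus of the projection of an i.i.d. complex Gaussian column on a fixed unit vector is
that of a `CN(0,1)` variable. -/
lemma pi_column_projection {N : ℕ} {ι : Type*} [Fintype ι] (e : ι ≃ Fin N) {n : Fin N → ℂ}
    (hn : normSq n = 1) {S : Set ℝ} (hS : MeasurableSet S) :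
    Measure.pi (fun _ : ι => stdComplexGaussian) {x | ‖star n ⬝ᵥ (x ∘ e.symm)‖ ^ 2 ∈ S} =
      stdComplexGaussian {z | ‖z‖ ^ 2 ∈ S} := by
  -- The row vector `nᴴ` is a co-isometry onto one coordinate because `n` is a unit vector.
  let B : Matrix Unit ι ℂ := Matrix.of fun _ k => star (n (e k))
  have hB : B * Bᴴ = 1 := by
    ext
    have : ∑ k, star (n (e k)) * n (e k) = 1 := by
      rw [e.sum_comp (fun i => star (n i) * n i)]
      have h1 : ∀ i, star (n i) * n i = ((‖n i‖ ^ 2 : ℝ) : ℂ) := by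
        intro i; simp [Complex.conj_mul']
      simp_rw [h1]
      rw [← Complex.ofReal_sum, ← normSq_eq_sum, hn, Complex.ofReal_one]
    simpa [B, Matrix.mul_apply] using this
  have hS' : MeasurableSet {z : ℂ | ‖z‖ ^ 2 ∈ S} := by
    have : Measurable fun z : ℂ => ‖z‖ ^ 2 := by fun_prop
    exact this hS
  have hev := measurePreserving_eval (fun _ : Unit => stdComplexGaussian) ()
  have hBm : Measurable fun x : ι → ℂ => B *ᵥ x := by
    apply Continuous.measurable; fun_prop
  rw [← hev.measure_preimage hS'.nullMeasurableSet, ← map_mulVec_pi_stdComplexGaussian B hB,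
    Measure.map_apply hBm (hev.measurable hS')]
  congr 1
  ext x
  have : star n ⬝ᵥ (x ∘ e.symm) = (B *ᵥ x) () := by
    simp only [dotProduct, Matrix.mulVec, B, Function.comp_apply, Pi.star_apply, Matrix.of_apply]
    rw [← e.sum_comp]
    simp
  simp only [Set.mem_ofPred_eq, Set.mem_preimage, Function.eval]
  rw [this]

/-- The column index set of the `m`-th column. -/
def columnEquiv {N : ℕ} (m : Fin N) : {k : Fin N × Fin N // ¬ k.2 ≠ m} ≃ Fin N where
  toFun k := k.1.1
  invFun i := ⟨(i, m), by simp⟩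
  left_inv k := by
    obtain ⟨⟨i, j⟩, h⟩ := k
    simp only [ne_eq, not_not] at h
    simp [h]
  right_inv _ := rfl

/-- Fubini over the split into column `m` and the rest: for almost every choice `y` of the rest, the
fibre has the same probability. -/
lemma pi_inv_normSq_inv_conjTranspose_single {N : ℕ} (m : Fin N) {S : Set ℝ}
    (hS : MeasurableSet S) :
    Measure.pi (fun _ : Fin N × Fin N => stdComplexGaussian)
      {g | (normSq ((Matrix.of fun i j => g (i, j))ᴴ⁻¹ *ᵥ Pi.single m 1))⁻¹ ∈ S} =
      stdComplexGaussian {z | ‖z‖ ^ 2 ∈ S} := by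
  set T := {g : Fin N × Fin N → ℂ |
    (normSq ((Matrix.of fun i j => g (i, j))ᴴ⁻¹ *ᵥ Pi.single m 1))⁻¹ ∈ S} with hT
  have hTm : MeasurableSet T :=
    ((continuous_normSq.measurable.comp (measurable_inv_conjTranspose_mulVec _)).inv) hS
  have he := (measurePreserving_piEquivPiSubtypeProd
    (fun _ : Fin N × Fin N => stdComplexGaussian) (fun k => k.2 ≠ m)).symm
  set e := (MeasurableEquiv.piEquivPiSubtypeProd (fun _ : Fin N × Fin N => ℂ)
    (fun k => k.2 ≠ m)).symm with hedef
  rw [← he.measure_preimage hTm.nullMeasurableSet, Measure.prod_apply (e.measurable hTm)]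
  have hdet := Measure.ae_ae_of_ae_prod (he.quasiMeasurePreserving.ae (ae_det_ne_zero N))
  have hconst : ∀ᵐ y ∂Measure.pi (fun _ : {k : Fin N × Fin N // k.2 ≠ m} => stdComplexGaussian),
      Measure.pi (fun _ : {k : Fin N × Fin N // ¬ k.2 ≠ m} => stdComplexGaussian)
        (Prod.mk y ⁻¹' (e ⁻¹' T)) = stdComplexGaussian {z | ‖z‖ ^ 2 ∈ S} := by
    filter_upwards [hdet] with y hy
    -- Filling column `m` with 0 makes `n` depend on `y` only, so it is a fixed vector when column
    -- `x` is integrated.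
    obtain ⟨n, hn, ho⟩ := exists_unit_orthogonal_columns
      (Matrix.of fun i j => e (y, 0) (i, j)) m
    rw [← pi_column_projection (columnEquiv m) hn hS]
    refine measure_congr ?_
    filter_upwards [hy] with x hx
    have hrest : ∀ i j, j ≠ m → e (y, x) (i, j) = e (y, 0) (i, j) := by
      intro i j hj
      simp [hedef, MeasurableEquiv.piEquivPiSubtypeProd, Equiv.piEquivPiSubtypeProd, hj]
    have hcol : (Matrix.of fun i j => e (y, x) (i, j)).col m = x ∘ (columnEquiv m).symm := by
      ext i
      simp [hedef, MeasurableEquiv.piEquivPiSubtypeProd, Equiv.piEquivPiSubtypeProd, columnEquiv]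
    have ho' : ∀ j, j ≠ m → star n ⬝ᵥ (Matrix.of fun i j => e (y, x) (i, j)).col j = 0 := by
      intro j hj
      rw [← ho j hj]
      congr 1
      ext i
      exact hrest i j hj
    have hkey := inv_normSq_inv_conjTranspose_mulVec_single hx hn ho'
    rw [hcol] at hkey
    apply propext
    change (normSq ((Matrix.of fun i j => e (y, x) (i, j))ᴴ⁻¹ *ᵥ Pi.single m 1))⁻¹ ∈ S ↔ _ ∈ S
    rw [hkey]
  rw [lintegral_congr_ae hconst]
  simp

/-- Right multiplication by a unitary matrix preserves the law of an i.i.d. complex Gaussian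
matrix. -/
lemma measurePreserving_mul_unitary {N M : ℕ} {U : Matrix (Fin M) (Fin M) ℂ}
    (hU : U ∈ Matrix.unitaryGroup (Fin M) ℂ) :
    MeasurePreserving
      (fun (g : Fin N × Fin M → ℂ) (k : Fin N × Fin M) =>
        ((Matrix.of fun i j => g (i, j)) * U : Matrix (Fin N) (Fin M) ℂ) k.1 k.2)
      (Measure.pi (fun _ : Fin N × Fin M => stdComplexGaussian))
      (Measure.pi (fun _ : Fin N × Fin M => stdComplexGaussian)) := by
  -- On entries indexed by pairs, `G ↦ G U` is the linear map `1 ⊗ Uᵀ`, which is unitary.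
  have hB : (Matrix.kronecker (1 : Matrix (Fin N) (Fin N) ℂ) Uᵀ) *
      (Matrix.kronecker (1 : Matrix (Fin N) (Fin N) ℂ) Uᵀ)ᴴ = 1 := by
    have h1 : Uᵀ * Uᵀᴴ = 1 := by
      have := congrArg Matrix.transpose (Matrix.mem_unitaryGroup_iff'.1 hU)
      rwa [Matrix.transpose_mul, Matrix.transpose_one] at this
    rw [Matrix.kronecker, Matrix.conjTranspose_kronecker, ← Matrix.mul_kronecker_mul, h1]
    simp
  have heq : (fun (g : Fin N × Fin M → ℂ) (k : Fin N × Fin M) =>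
        ((Matrix.of fun i j => g (i, j)) * U : Matrix (Fin N) (Fin M) ℂ) k.1 k.2) =
      fun g => (Matrix.kronecker (1 : Matrix (Fin N) (Fin N) ℂ) Uᵀ) *ᵥ g := by
    ext g ⟨i, j⟩
    simp [Matrix.mul_apply, Matrix.mulVec, dotProduct, Fintype.sum_prod_type, Matrix.kronecker,
      Matrix.one_apply, mul_comm]
  rw [heq]
  refine ⟨?_, map_mulVec_pi_stdComplexGaussian _ hB⟩
  apply Continuous.measurable; fun_prop

/-- Since `(Uᴴ)⁻¹ = U`, one has `(G U)⁻ᴴ e_m = G⁻ᴴ U e_m`, and `G U` has the law of `G`. -/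
lemma pi_inv_normSq_inv_conjTranspose_col {N : ℕ} {U : Matrix (Fin N) (Fin N) ℂ}
    (hU : U ∈ Matrix.unitaryGroup (Fin N) ℂ) (m : Fin N) {S : Set ℝ} (hS : MeasurableSet S) :
    Measure.pi (fun _ : Fin N × Fin N => stdComplexGaussian)
      {g | (normSq ((Matrix.of fun i j => g (i, j))ᴴ⁻¹ *ᵥ U.col m))⁻¹ ∈ S} =
      stdComplexGaussian {z | ‖z‖ ^ 2 ∈ S} := by
  have hTm : MeasurableSet {g : Fin N × Fin N → ℂ |
      (normSq ((Matrix.of fun i j => g (i, j))ᴴ⁻¹ *ᵥ Pi.single m 1))⁻¹ ∈ S} :=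
    ((continuous_normSq.measurable.comp (measurable_inv_conjTranspose_mulVec _)).inv) hS
  rw [← pi_inv_normSq_inv_conjTranspose_single m hS,
    ← (measurePreserving_mul_unitary hU).measure_preimage hTm.nullMeasurableSet]
  congr 1
  ext g
  have hinv : Uᴴ⁻¹ = U := Matrix.inv_eq_right_inv (Matrix.mem_unitaryGroup_iff'.1 hU)
  have h : ((Matrix.of fun i j => g (i, j)) * U)ᴴ⁻¹ *ᵥ Pi.single m 1 =
      (Matrix.of fun i j => g (i, j))ᴴ⁻¹ *ᵥ U.col m := by
    rw [Matrix.conjTranspose_mul, Matrix.mul_inv_rev, hinv, ← Matrix.mulVec_mulVec,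
      Matrix.mulVec_single_one]
  have hof : (Matrix.of fun i j => ((Matrix.of fun i j => g (i, j)) * U) i j) =
      (Matrix.of fun i j => g (i, j)) * U := rfl
  simp only [Set.mem_preimage, Set.mem_ofPred_eq]
  rw [← h]
  rfl

/-! ### The sensing-centric design is the water-filling solution -/

/-- Tangent-line bound for the concave logarithm at `y`. The slope `a / (1 + a y)` equals `ν` on an
active direction; on an inactive one it is `a ≤ ν`, and `x ≥ 0` gives the right sign. -/
lemma log_one_add_mul_le {a x y ν : ℝ} (ha : 0 < a) (hx : 0 ≤ x) (hν : 0 < ν)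
    (hy : y = max 0 (1 / ν - 1 / a)) :
    Real.log (1 + a * x) ≤ Real.log (1 + a * y) + ν * (x - y) := by
  have hy0 : 0 ≤ y := hy ▸ le_max_left _ _
  have h1 : 0 < 1 + a * x := by positivity
  have h2 : 0 < 1 + a * y := by positivity
  have h3 := Real.log_le_sub_one_of_pos (div_pos h1 h2)
  rw [Real.log_div h1.ne' h2.ne'] at h3
  have h4 : (1 + a * x) / (1 + a * y) - 1 ≤ ν * (x - y) := by
    rw [div_sub_one h2.ne', div_le_iff₀ h2]
    rcases le_total (1 / ν - 1 / a) 0 with h | h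
    · rw [max_eq_left h] at hy
      have h5 : a ≤ ν := (one_div_le_one_div hν ha).1 (sub_nonpos.1 h)
      subst hy
      nlinarith [mul_le_mul_of_nonneg_right h5 hx]
    · rw [max_eq_right h] at hy
      have h5 : ν * (1 + a * y) = a := by rw [hy]; field_simp; ring
      nlinarith
  linarith

lemma eq_of_log_one_add_mul_eq {a x y ν : ℝ} (ha : 0 < a) (hx : 0 ≤ x) (hν : 0 < ν)
    (hy : y = 1 / ν - 1 / a) (hy0 : 0 ≤ y)
    (h : Real.log (1 + a * x) = Real.log (1 + a * y) + ν * (x - y)) : x = y := by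
  have h1 : 0 < 1 + a * x := by positivity
  have h2 : 0 < 1 + a * y := by positivity
  by_contra hne
  have h3 := Real.log_lt_sub_one_of_pos (div_pos h1 h2) (by
    intro he
    rw [div_eq_one_iff_eq h2.ne'] at he
    exact hne (mul_left_cancel₀ ha.ne' (add_left_cancel he)))
  rw [Real.log_div h1.ne' h2.ne', div_sub_one h2.ne', lt_div_iff₀ h2] at h3
  have h5 : ν * (1 + a * y) = a := by rw [hy]; field_simp; ring
  rw [h] at h3
  nlinarith

/-- The water-filling powers are the unique maximizer of the sum of the logarithms. -/
lemma eq_of_sum_log_le {ι : Type*} [Fintype ι] {a q s : ι → ℝ} {ν : ℝ} (ha : ∀ i, 0 < a i)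
    (hq : ∀ i, 0 ≤ q i) (hν : 0 < ν) (hs : ∀ i, s i = max 0 (1 / ν - 1 / a i))
    (hsum : ∑ i, q i ≤ ∑ i, s i)
    (hmax : ∑ i, Real.log (1 + a i * s i) ≤ ∑ i, Real.log (1 + a i * q i)) {m : ι}
    (hm : 0 < s m) : q m = s m := by
  have hle := fun i => log_one_add_mul_le (ha i) (hq i) hν (hs i)
  -- The budget makes the multiplier term nonpositive. Optimality then forces equality in the sum of
  -- the tangent bounds, hence in each of them.
  have htot : ∑ i, (Real.log (1 + a i * s i) + ν * (q i - s i)) ≤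
      ∑ i, Real.log (1 + a i * q i) := by
    rw [Finset.sum_add_distrib, ← Finset.mul_sum, Finset.sum_sub_distrib]
    nlinarith [mul_nonneg hν.le (sub_nonneg.2 hsum)]
  have heq := (Finset.sum_eq_sum_iff_of_le fun i _ => hle i).1
    (le_antisymm (Finset.sum_le_sum fun i _ => hle i) htot) m (Finset.mem_univ m)
  have hsm : s m = 1 / ν - 1 / a m := by
    rw [hs m] at hm ⊢
    refine max_eq_right (le_of_lt ?_)
    rcases lt_max_iff.1 hm with h | h
    · exact absurd h (lt_irrefl _)
    · exact h
  exact eq_of_log_one_add_mul_eq (ha m) (hq m) hν hsm hm.le heq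

lemma conjTranspose_precoder {M : ℕ} (U : Matrix (Fin M) (Fin M) ℂ) (q : Fin M → ℝ) :
    (precoder U q)ᴴ = Matrix.diagonal (fun i => ((Real.sqrt (q i) : ℝ) : ℂ)) * Uᴴ := by
  rw [precoder, Matrix.conjTranspose_mul, Matrix.diagonal_conjTranspose]
  congr 2
  ext i
  simp

lemma sqrt_mul_sqrt_cast {x : ℝ} (hx : 0 ≤ x) :
    ((Real.sqrt x : ℝ) : ℂ) * ((Real.sqrt x : ℝ) : ℂ) = (x : ℂ) := by
  rw [← Complex.ofReal_mul, Real.mul_self_sqrt hx]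

lemma trace_precoder {M : ℕ} {U : Matrix (Fin M) (Fin M) ℂ}
    (hU : U ∈ Matrix.unitaryGroup (Fin M) ℂ) {q : Fin M → ℝ} (hq : ∀ i, 0 ≤ q i) :
    (precoder U q * (precoder U q)ᴴ).trace.re = ∑ i, q i := by
  have hU' : Uᴴ * U = 1 := Matrix.mem_unitaryGroup_iff'.1 hU
  rw [Matrix.trace_mul_comm, conjTranspose_precoder, precoder, Matrix.mul_assoc,
    ← Matrix.mul_assoc Uᴴ, hU', Matrix.one_mul, Matrix.diagonal_mul_diagonal,
    Matrix.trace_diagonal, Complex.re_sum]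
  exact Finset.sum_congr rfl fun i _ => by rw [sqrt_mul_sqrt_cast (hq i), Complex.ofReal_re]

/-- Precoding along the eigenvectors of `R` decouples the determinant into scalar channels. -/
lemma sensingRate_precoder {M : ℕ} (L : ℕ) {R U : Matrix (Fin M) (Fin M) ℂ} {lam q : Fin M → ℝ}
    (hU : U ∈ Matrix.unitaryGroup (Fin M) ℂ)
    (hR : R = U * Matrix.diagonal (fun i => (lam i : ℂ)) * Uᴴ) (hq : ∀ i, 0 ≤ q i) :
    sensingRate L R (precoder U q) = (M : ℝ) / L * Real.logb 2 (∏ i, (1 + L * lam i * q i)) := by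
  have hU' : Uᴴ * U = 1 := Matrix.mem_unitaryGroup_iff'.1 hU
  have h : (precoder U q)ᴴ * R * precoder U q =
      Matrix.diagonal (fun i => ((lam i * q i : ℝ) : ℂ)) := by
    have : (precoder U q)ᴴ * R * precoder U q =
        Matrix.diagonal (fun i => ((Real.sqrt (q i) : ℝ) : ℂ)) * (Uᴴ * U) *
          Matrix.diagonal (fun i => (lam i : ℂ)) * (Uᴴ * U) *
          Matrix.diagonal (fun i => ((Real.sqrt (q i) : ℝ) : ℂ)) := by
      rw [conjTranspose_precoder, hR, precoder]
      simp only [Matrix.mul_assoc]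
    rw [this, hU', Matrix.mul_one, Matrix.mul_one, Matrix.diagonal_mul_diagonal,
      Matrix.diagonal_mul_diagonal]
    congr 1
    ext i
    rw [mul_right_comm, sqrt_mul_sqrt_cast (hq i)]
    push_cast
    ring
  have hdet : (1 + (L : ℂ) • ((precoder U q)ᴴ * R * precoder U q)).det =
      ((∏ i, (1 + L * lam i * q i) : ℝ) : ℂ) := by
    rw [h, ← Matrix.diagonal_one, ← Matrix.diagonal_smul, Matrix.diagonal_add,
      Matrix.det_diagonal]
    push_cast
    exact Finset.prod_congr rfl fun i _ => by simp [mul_assoc]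
  rw [sensingRate, hdet, Complex.ofReal_re]

lemma eigenvalue_pos_of_posDef {M : ℕ} {R U : Matrix (Fin M) (Fin M) ℂ} {lam : Fin M → ℝ}
    (hR : R.PosDef) (hU : U ∈ Matrix.unitaryGroup (Fin M) ℂ)
    (hdec : R = U * Matrix.diagonal (fun i => (lam i : ℂ)) * Uᴴ) (i : Fin M) : 0 < lam i := by
  have hU' : Uᴴ * U = 1 := Matrix.mem_unitaryGroup_iff'.1 hU
  have hinj : Function.Injective U.mulVec := by
    intro x y hxy
    have := congrArg (fun z => Uᴴ *ᵥ z) hxy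
    simpa [Matrix.mulVec_mulVec, hU'] using this
  have h := hR.conjTranspose_mul_mul_same hinj
  have hdiag : Uᴴ * R * U = Matrix.diagonal (fun i => (lam i : ℂ)) := by
    have : Uᴴ * R * U = (Uᴴ * U) * Matrix.diagonal (fun i => (lam i : ℂ)) * (Uᴴ * U) := by
      rw [hdec]; simp only [Matrix.mul_assoc]
    rw [this, hU', Matrix.one_mul, Matrix.mul_one]
  rw [hdiag, Matrix.posDef_diagonal_iff] at h
  exact_mod_cast h i

/-- On the active eigendirections, the powers of the sensing-centric design are the
water-filling powers. -/
lemma IsSensingCentric.power_eq_waterFilling {M L : ℕ} (hL : 0 < L) {p : ℝ}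
    {R U : Matrix (Fin M) (Fin M) ℂ} {lam q : Fin M → ℝ} (hR : R.PosDef)
    (hdesign : IsSensingCentric L p R U lam q) {ν : ℝ}
    (hν : ∑ i, waterFilling L lam ν i = p) {m : Fin M} (hs : 0 < waterFilling L lam ν m) :
    q m = waterFilling L lam ν m := by
  have hlam := eigenvalue_pos_of_posDef hR hdesign.unitary hdesign.eigendecomposition
  have hL' : (0 : ℝ) < L := by exact_mod_cast hL
  have ha : ∀ i, 0 < L * lam i := fun i => mul_pos hL' (hlam i)
  have hM : (0 : ℝ) < M := by exact_mod_cast Fin.pos m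
  -- A nonpositive `ν` (including `1 / 0 = 0`) would leave direction `m` without power.
  have hν0 : 0 < ν := by
    by_contra hneg
    have h1 : 1 / ν ≤ 0 := one_div_nonpos.2 (not_lt.1 hneg)
    have h2 := one_div_pos.2 (ha m)
    have : waterFilling L lam ν m = 0 := max_eq_left (by linarith)
    linarith
  have hs0 : ∀ i, 0 ≤ waterFilling L lam ν i := fun i => le_max_left _ _
  have hbud := hdesign.budget
  rw [trace_precoder hdesign.unitary hdesign.power_nonneg] at hbud
  have hmax := hdesign.maximal (precoder U (waterFilling L lam ν))
    (by rw [trace_precoder hdesign.unitary hs0, hν])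
  rw [sensingRate_precoder L hdesign.unitary hdesign.eigendecomposition hs0,
    sensingRate_precoder L hdesign.unitary hdesign.eigendecomposition hdesign.power_nonneg] at hmax
  have hfac : ∀ r : Fin M → ℝ, (∀ i, 0 ≤ r i) → ∀ i, 0 < 1 + L * lam i * r i := fun r hr i => by
    have := mul_nonneg (ha i).le (hr i); linarith
  have hlog := (Real.logb_le_logb (by norm_num)
    (Finset.prod_pos fun i _ => hfac _ hs0 i)
    (Finset.prod_pos fun i _ => hfac _ hdesign.power_nonneg i)).1
      (le_of_mul_le_mul_left hmax (div_pos hM hL'))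
  have hlog' := Real.log_le_log (Finset.prod_pos fun i _ => hfac _ hs0 i) hlog
  rw [Real.log_prod (fun i _ => (hfac _ hs0 i).ne'),
    Real.log_prod (fun i _ => (hfac _ hdesign.power_nonneg i).ne')] at hlog'
  exact eq_of_sum_log_le ha hdesign.power_nonneg hν0 (fun i => rfl) (hν ▸ hbud) hlog' hs

/-! ### Outage events in terms of the detection vectors -/

lemma normSq_col_of_mem_unitaryGroup {M : ℕ} {U : Matrix (Fin M) (Fin M) ℂ}
    (hU : U ∈ Matrix.unitaryGroup (Fin M) ℂ) (m : Fin M) : normSq (U.col m) = 1 := by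
  have h := congrFun (congrFun (Matrix.mem_unitaryGroup_iff'.1 hU) m) m
  rw [normSq_eq_re]
  have h2 : star (U.col m) ⬝ᵥ U.col m = (1 : Matrix (Fin M) (Fin M) ℂ) m m := by
    rw [← h]; rfl
  rw [h2, Matrix.one_apply_eq, Complex.one_re]

lemma effectiveGain_eq_one {N M : ℕ} {H : Matrix (Fin N) (Fin M) ℂ} {v : Fin N → ℂ}
    {u : Fin M → ℂ} (hv : Hᴴ *ᵥ v = u) (hu : normSq u = 1) : effectiveGain H v u = 1 := by
  have h : star v ⬝ᵥ (H *ᵥ u) = ((normSq u : ℝ) : ℂ) := by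
    rw [Matrix.dotProduct_mulVec, ← Matrix.conjTranspose_conjTranspose H, ← Matrix.star_mulVec, hv,
      normSq_eq_sum, dotProduct]
    push_cast
    exact Finset.sum_congr rfl fun i _ => Complex.conj_mul' _
  rw [effectiveGain, h, hu]
  simp

lemma normSq_pos_of_alignment {N M : ℕ} {H : Matrix (Fin N) (Fin M) ℂ} {v : Fin N → ℂ}
    {u : Fin M → ℂ} (hv : Hᴴ *ᵥ v = u) (hu : normSq u = 1) : 0 < normSq v := by
  refine normSq_pos ?_
  rintro rfl
  rw [Matrix.mulVec_zero] at hv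
  rw [← hv] at hu
  simp [normSq] at hu

/-- The Rayleigh bound applied to `v`, whose image under `Hᴴ` has norm one. -/
lemma inv_normSq_le_maxEigenvalue {N M : ℕ} (hN : 0 < N) {H : Matrix (Fin N) (Fin M) ℂ}
    {v : Fin N → ℂ} {u : Fin M → ℂ} (hv : Hᴴ *ᵥ v = u) (hu : normSq u = 1) :
    (normSq v)⁻¹ ≤ maxEigenvalue H := by
  have h := normSq_conjTranspose_mulVec_le hN H v
  rw [hv, hu] at h
  rwa [inv_le_iff_one_le_mul₀ (normSq_pos_of_alignment hv hu)]

lemma lt_commRate_snrNear_iff {N M : ℕ} {α η s t : ℝ} (hα : 0 < α) (hη : 0 < η) (hs : 0 < s)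
    {H : Matrix (Fin N) (Fin M) ℂ} {v : Fin N → ℂ} {u : Fin M → ℂ} (hv : Hᴴ *ᵥ v = u)
    (hu : normSq u = 1) :
    t < commRate (snrNear α η s H v u) ↔ thresholdNear α η t / s < (normSq v)⁻¹ := by
  have hn := normSq_pos_of_alignment hv hu
  have hη' := inv_pos.2 hη
  rw [commRate, snrNear, effectiveGain_eq_one hv hu, thresholdNear,
    Real.lt_logb_iff_rpow_lt (by norm_num) (by positivity), div_div, div_lt_iff₀ (by positivity),
    inv_mul_eq_div, mul_one, sub_lt_iff_lt_add']

/-- As the shares sum to one, signal plus interference is the full received power. -/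
lemma one_add_sinrFar {N M : ℕ} {α α' η' s : ℝ} (hα : 0 < α) (hαα' : α + α' = 1) (hη' : 0 < η')
    (hs : 0 < s) {H : Matrix (Fin N) (Fin M) ℂ} {v : Fin N → ℂ} {u : Fin M → ℂ}
    (hv : Hᴴ *ᵥ v = u) (hu : normSq u = 1) :
    1 + sinrFar α α' η' s H v u = (η'⁻¹ * s + normSq v) / (α * (η'⁻¹ * s) + normSq v) := by
  have hn := normSq_pos_of_alignment hv hu
  have hη'' := inv_pos.2 hη'
  have hd : 0 < α * (η'⁻¹ * s) + normSq v := by positivity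
  rw [sinrFar, effectiveGain_eq_one hv hu, mul_one, mul_one, mul_assoc, mul_assoc,
    eq_div_iff hd.ne', add_mul, div_mul_cancel₀ _ hd.ne']
  linear_combination (η'⁻¹ * s) * hαα'

lemma thresholdFar_div {α η' s t' : ℝ} :
    thresholdFar α η' t' / s = ((2 : ℝ) ^ t' - 1) / (η'⁻¹ * s * (1 - (2 : ℝ) ^ t' * α)) := by
  rw [thresholdFar, div_div]
  congr 1
  ring

/-- With `c = s / η'` and `T = 2 ^ t'`, clearing denominators gives `(T - 1) ‖v‖² < c (1 - T α)`;
isolating `1 / ‖v‖²` needs `T α < 1`. -/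
lemma lt_commRate_sinrFar_iff {N M : ℕ} {α α' η' s t' : ℝ} (hα : 0 < α) (hαα' : α + α' = 1)
    (hη' : 0 < η') (hs : 0 < s) (ht : (2 : ℝ) ^ t' * α < 1) {H : Matrix (Fin N) (Fin M) ℂ}
    {v : Fin N → ℂ} {u : Fin M → ℂ} (hv : Hᴴ *ᵥ v = u) (hu : normSq u = 1) :
    t' < commRate (sinrFar α α' η' s H v u) ↔ thresholdFar α η' t' / s < (normSq v)⁻¹ := by
  have hn := normSq_pos_of_alignment hv hu
  have hη'' := inv_pos.2 hη'
  have hd : 0 < α * (η'⁻¹ * s) + normSq v := by positivity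
  have hc : 0 < η'⁻¹ * s * (1 - (2 : ℝ) ^ t' * α) := mul_pos (by positivity) (by linarith)
  rw [commRate, one_add_sinrFar hα hαα' hη' hs hv hu,
    Real.lt_logb_iff_rpow_lt (by norm_num) (by positivity), lt_div_iff₀ hd, thresholdFar_div,
    div_lt_iff₀ hc, mul_comm (normSq v)⁻¹, ← div_eq_mul_inv, lt_div_iff₀ hn]
  constructor <;> intro h <;> nlinarith

lemma commRate_sinrFar_lt_iff {N M : ℕ} {α α' η' s t' : ℝ} (hα : 0 < α) (hαα' : α + α' = 1)
    (hη' : 0 < η') (hs : 0 < s) (ht : (2 : ℝ) ^ t' * α < 1) {H : Matrix (Fin N) (Fin M) ℂ}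
    {v : Fin N → ℂ} {u : Fin M → ℂ} (hv : Hᴴ *ᵥ v = u) (hu : normSq u = 1) :
    commRate (sinrFar α α' η' s H v u) < t' ↔ (normSq v)⁻¹ < thresholdFar α η' t' / s := by
  have hn := normSq_pos_of_alignment hv hu
  have hη'' := inv_pos.2 hη'
  have hd : 0 < α * (η'⁻¹ * s) + normSq v := by positivity
  have hc : 0 < η'⁻¹ * s * (1 - (2 : ℝ) ^ t' * α) := mul_pos (by positivity) (by linarith)
  rw [commRate, one_add_sinrFar hα hαα' hη' hs hv hu,
    Real.logb_lt_iff_lt_rpow (by norm_num) (by positivity), div_lt_iff₀ hd, thresholdFar_div,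
    lt_div_iff₀ hc, mul_comm (normSq v)⁻¹, ← div_eq_mul_inv, div_lt_iff₀ hn]
  constructor <;> intro h <;> nlinarith

/-- Interference-limited far user: the target rate is never met. -/
lemma commRate_sinrFar_lt_of_one_le {N M : ℕ} {α α' η' s t' : ℝ} (hα : 0 < α) (hα' : 0 < α')
    (hαα' : α + α' = 1) (hη' : 0 < η') (hs : 0 < s) (ht : 1 ≤ (2 : ℝ) ^ t' * α)
    {H : Matrix (Fin N) (Fin M) ℂ} {v : Fin N → ℂ} {u : Fin M → ℂ} (hv : Hᴴ *ᵥ v = u)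
    (hu : normSq u = 1) : commRate (sinrFar α α' η' s H v u) < t' := by
  have hn := normSq_pos_of_alignment hv hu
  have hη'' := inv_pos.2 hη'
  have hc : 0 < η'⁻¹ * s := by positivity
  have hd : 0 < α * (η'⁻¹ * s) + normSq v := by positivity
  rw [commRate, one_add_sinrFar hα hαα' hη' hs hv hu,
    Real.logb_lt_iff_lt_rpow (by norm_num) (by positivity), div_lt_iff₀ hd]
  have hT : 1 < (2 : ℝ) ^ t' := by nlinarith [Real.rpow_pos_of_pos (by norm_num : (0 : ℝ) < 2) t']
  nlinarith [mul_pos (sub_pos.2 hT) hn, mul_nonneg (sub_nonneg.2 ht) hc.le]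

/-! ### The joint law of the two channels -/

section Pair

variable {Ω : Type*} [MeasurableSpace Ω] {P : Measure Ω} {N M : ℕ}
  {H H' : Ω → Matrix (Fin N) (Fin M) ℂ}

/-- Independence of all `2NM` entries is a product law over a sum of index sets, which splits into
the product of the two channel laws. -/
lemma IsRayleighPair.aemeasurable_and_map_eq (hH : IsRayleighPair P H H') :
    AEMeasurable (fun ω => ((fun k : Fin N × Fin M => H ω k.1 k.2),
      (fun k : Fin N × Fin M => H' ω k.1 k.2))) P ∧
    P.map (fun ω => ((fun k : Fin N × Fin M => H ω k.1 k.2),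
      (fun k : Fin N × Fin M => H' ω k.1 k.2))) =
      (Measure.pi (fun _ : Fin N × Fin M => stdComplexGaussian)).prod
        (Measure.pi (fun _ : Fin N × Fin M => stdComplexGaussian)) := by
  let Z : (Fin N × Fin M) ⊕ (Fin N × Fin M) → Ω → ℂ := fun k ω =>
    Sum.elim (fun a => H ω a.1 a.2) (fun a => H' ω a.1 a.2) k
  have hm : ∀ k, AEMeasurable (Z k) P := by
    rintro (k | k)
    · exact (hH.law k.1 k.2).aemeasurable
    · exact (hH.law' k.1 k.2).aemeasurable
  have hlaw : ∀ k, P.map (Z k) = stdComplexGaussian := by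
    rintro (k | k)
    · exact (hH.law k.1 k.2).map_eq
    · exact (hH.law' k.1 k.2).map_eq
  have hprob := hH.indep.isProbabilityMeasure
  have hpi := hH.indep.map_fun_eq_pi_map hm
  have hZ : AEMeasurable (fun ω k => Z k ω) P := aemeasurable_pi_lambda _ hm
  have hpi' : P.map (fun ω k => Z k ω) = Measure.pi fun _ => stdComplexGaussian := by
    refine hpi.trans ?_
    congr 1
    ext1 k
    exact hlaw k
  have he := measurePreserving_sumPiEquivProdPi
    (fun _ : (Fin N × Fin M) ⊕ (Fin N × Fin M) => stdComplexGaussian)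
  refine ⟨he.measurable.comp_aemeasurable hZ, ?_⟩
  have h := he.map_eq
  rw [← hpi', AEMeasurable.map_map_of_aemeasurable he.measurable.aemeasurable hZ] at h
  exact h

lemma IsRayleighPair.measure_and (hH : IsRayleighPair P H H')
    {A B : Set (Fin N × Fin M → ℂ)} (hA : MeasurableSet A) (hB : MeasurableSet B) :
    P {ω | (fun k : Fin N × Fin M => H ω k.1 k.2) ∈ A ∧
      (fun k : Fin N × Fin M => H' ω k.1 k.2) ∈ B} =
      Measure.pi (fun _ : Fin N × Fin M => stdComplexGaussian) A *
        Measure.pi (fun _ : Fin N × Fin M => stdComplexGaussian) B := by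
  obtain ⟨hm, hmap⟩ := hH.aemeasurable_and_map_eq
  rw [← Measure.prod_prod, ← hmap, Measure.map_apply_of_aemeasurable hm (hA.prod hB)]
  rfl

lemma IsRayleighPair.measureReal_and (hH : IsRayleighPair P H H')
    {A B : Set (Fin N × Fin M → ℂ)} (hA : MeasurableSet A) (hB : MeasurableSet B) :
    P.real {ω | (fun k : Fin N × Fin M => H ω k.1 k.2) ∈ A ∧
      (fun k : Fin N × Fin M => H' ω k.1 k.2) ∈ B} =
      (Measure.pi (fun _ : Fin N × Fin M => stdComplexGaussian)).real A *
        (Measure.pi (fun _ : Fin N × Fin M => stdComplexGaussian)).real B := by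
  rw [measureReal_def, hH.measure_and hA hB, ENNReal.toReal_mul]
  rfl

lemma IsRayleighPair.measure_right (hH : IsRayleighPair P H H')
    {B : Set (Fin N × Fin M → ℂ)} (hB : MeasurableSet B) :
    P {ω | (fun k : Fin N × Fin M => H' ω k.1 k.2) ∈ B} =
      Measure.pi (fun _ : Fin N × Fin M => stdComplexGaussian) B := by
  have h := hH.measure_and MeasurableSet.univ hB
  simpa using h

lemma measureReal_lt_maxEigenvalue (hN : 0 < N) (x : ℝ) :
    (Measure.pi (fun _ : Fin N × Fin M => stdComplexGaussian)).real
      {g | x < maxEigenvalue (Matrix.of fun i j => g (i, j))} = 1 - wishartMaxCDF N M x := by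
  rw [wishartMaxCDF, ← probReal_compl_eq_one_sub
    (measurableSet_le (measurable_maxEigenvalue hN) measurable_const)]
  congr 1
  ext g
  simp

lemma measureReal_maxEigenvalue_lt (hN : 0 < N) (hM : 0 < M) (x : ℝ) :
    (Measure.pi (fun _ : Fin N × Fin M => stdComplexGaussian)).real
      {g | maxEigenvalue (Matrix.of fun i j => g (i, j)) < x} = wishartMaxCDF N M x := by
  rw [wishartMaxCDF, measureReal_def, measureReal_def]
  congr 1
  refine measure_congr ?_
  filter_upwards [measure_eq_zero_iff_ae_notMem.1 (pi_maxEigenvalue_eq_null hN hM x)] with g hg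
  exact propext ⟨fun h => le_of_lt h, fun h => lt_of_le_of_ne h hg⟩

lemma wishartMaxCDF_le_one (x : ℝ) : wishartMaxCDF N M x ≤ 1 := measureReal_le_one

/-- Both aligned users are jointly above their thresholds with probability at most the product of
the complementary Wishart distribution functions. -/
lemma IsRayleighPair.measureReal_inv_normSq_le [IsProbabilityMeasure P]
    (hH : IsRayleighPair P H H') (hN : 0 < N) {v v' : Ω → Fin N → ℂ} {u : Fin M → ℂ}
    (hu : normSq u = 1) (hv : ∀ᵐ ω ∂P, (H ω)ᴴ *ᵥ v ω = u) (hv' : ∀ᵐ ω ∂P, (H' ω)ᴴ *ᵥ v' ω = u)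
    (a b : ℝ) :
    P.real {ω | a < (normSq (v ω))⁻¹ ∧ b < (normSq (v' ω))⁻¹} ≤
      (1 - wishartMaxCDF N M a) * (1 - wishartMaxCDF N M b) := by
  rw [← measureReal_lt_maxEigenvalue hN, ← measureReal_lt_maxEigenvalue hN,
    ← hH.measureReal_and (measurableSet_lt measurable_const (measurable_maxEigenvalue hN))
      (measurableSet_lt measurable_const (measurable_maxEigenvalue hN))]
  refine ENNReal.toReal_mono (measure_ne_top _ _) (measure_mono_ae ?_)
  filter_upwards [hv, hv'] with ω h h' hω
  exact ⟨hω.1.trans_le (inv_normSq_le_maxEigenvalue hN h hu),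
    hω.2.trans_le (inv_normSq_le_maxEigenvalue hN h' hu)⟩

lemma IsRayleighPair.wishartMaxCDF_le [IsProbabilityMeasure P]
    (hH : IsRayleighPair P H H') (hN : 0 < N) (hM : 0 < M) {v' : Ω → Fin N → ℂ} {u : Fin M → ℂ}
    (hu : normSq u = 1) (hv' : ∀ᵐ ω ∂P, (H' ω)ᴴ *ᵥ v' ω = u) (b : ℝ) :
    wishartMaxCDF N M b ≤ P.real {ω | (normSq (v' ω))⁻¹ < b} := by
  rw [← measureReal_maxEigenvalue_lt hN hM, measureReal_def,
    ← hH.measure_right (measurableSet_lt (measurable_maxEigenvalue hN) measurable_const)]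
  refine ENNReal.toReal_mono (measure_ne_top _ _) (measure_mono_ae ?_)
  filter_upwards [hv'] with ω h' hω
  exact (inv_normSq_le_maxEigenvalue hN h' hu).trans_lt hω

end Pair

/-! ### Square channels: exact exponential gains -/

section Square

variable {Ω : Type*} [MeasurableSpace Ω] {P : Measure Ω} {N : ℕ}
  {H H' : Ω → Matrix (Fin N) (Fin N) ℂ}

lemma eq_inv_conjTranspose_mulVec {H : Matrix (Fin N) (Fin N) ℂ} (hdet : H.det ≠ 0)
    {v u : Fin N → ℂ} (hv : Hᴴ *ᵥ v = u) : v = Hᴴ⁻¹ *ᵥ u := by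
  have hu : IsUnit (Hᴴ).det := by
    rw [Matrix.det_conjTranspose]; exact (star_ne_zero.2 hdet).isUnit
  rw [← hv, Matrix.mulVec_mulVec, Matrix.nonsing_inv_mul _ hu, Matrix.one_mulVec]

lemma measurableSet_zeroForcingGain (u : Fin N → ℂ) {S : Set ℝ} (hS : MeasurableSet S) :
    MeasurableSet {g : Fin N × Fin N → ℂ |
      (normSq ((Matrix.of fun i j => g (i, j))ᴴ⁻¹ *ᵥ u))⁻¹ ∈ S} :=
  ((continuous_normSq.measurable.comp (measurable_inv_conjTranspose_mulVec _)).inv) hS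

lemma IsRayleighPair.ae_det_ne_zero [IsProbabilityMeasure P] (hH : IsRayleighPair P H H') :
    ∀ᵐ ω ∂P, (H ω).det ≠ 0 ∧ (H' ω).det ≠ 0 := by
  obtain ⟨hm, hmap⟩ := hH.aemeasurable_and_map_eq
  refine ae_of_ae_map hm (p := fun g => (Matrix.of fun i j => g.1 (i, j)).det ≠ 0 ∧
    (Matrix.of fun i j => g.2 (i, j)).det ≠ 0) ?_
  rw [hmap]
  exact (Measure.quasiMeasurePreserving_fst.ae (NomaIsac.ae_det_ne_zero N)).and
    (Measure.quasiMeasurePreserving_snd.ae (NomaIsac.ae_det_ne_zero N))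

/-- In the square case the gains of the aligned users are independent and exponential. -/
lemma IsRayleighPair.measure_inv_normSq_and [IsProbabilityMeasure P]
    (hH : IsRayleighPair P H H') {U : Matrix (Fin N) (Fin N) ℂ}
    (hU : U ∈ Matrix.unitaryGroup (Fin N) ℂ) (m : Fin N) {v v' : Ω → Fin N → ℂ}
    (hv : ∀ᵐ ω ∂P, (H ω)ᴴ *ᵥ v ω = U.col m) (hv' : ∀ᵐ ω ∂P, (H' ω)ᴴ *ᵥ v' ω = U.col m)
    {A B : Set ℝ} (hA : MeasurableSet A) (hB : MeasurableSet B) :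
    P {ω | (normSq (v ω))⁻¹ ∈ A ∧ (normSq (v' ω))⁻¹ ∈ B} =
      stdComplexGaussian {z | ‖z‖ ^ 2 ∈ A} * stdComplexGaussian {z | ‖z‖ ^ 2 ∈ B} := by
  rw [← pi_inv_normSq_inv_conjTranspose_col hU m hA, ← pi_inv_normSq_inv_conjTranspose_col hU m hB,
    ← hH.measure_and (measurableSet_zeroForcingGain _ hA) (measurableSet_zeroForcingGain _ hB)]
  refine measure_congr ?_
  filter_upwards [hv, hv', hH.ae_det_ne_zero] with ω h h' hdet
  apply propext
  change (normSq (v ω))⁻¹ ∈ A ∧ (normSq (v' ω))⁻¹ ∈ B ↔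
    (normSq ((H ω)ᴴ⁻¹ *ᵥ U.col m))⁻¹ ∈ A ∧ (normSq ((H' ω)ᴴ⁻¹ *ᵥ U.col m))⁻¹ ∈ B
  rw [← eq_inv_conjTranspose_mulVec hdet.1 h, ← eq_inv_conjTranspose_mulVec hdet.2 h']

lemma IsRayleighPair.measureReal_lt_inv_normSq_and [IsProbabilityMeasure P]
    (hH : IsRayleighPair P H H') {U : Matrix (Fin N) (Fin N) ℂ}
    (hU : U ∈ Matrix.unitaryGroup (Fin N) ℂ) (m : Fin N) {v v' : Ω → Fin N → ℂ}
    (hv : ∀ᵐ ω ∂P, (H ω)ᴴ *ᵥ v ω = U.col m) (hv' : ∀ᵐ ω ∂P, (H' ω)ᴴ *ᵥ v' ω = U.col m)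
    {a b : ℝ} (ha : 0 ≤ a) (hb : 0 ≤ b) :
    P.real {ω | a < (normSq (v ω))⁻¹ ∧ b < (normSq (v' ω))⁻¹} = Real.exp (-(a + b)) := by
  have h := hH.measure_inv_normSq_and hU m hv hv' (measurableSet_Ioi (a := a))
    (measurableSet_Ioi (a := b))
  simp only [Set.mem_Ioi] at h
  rw [measureReal_def, h, stdComplexGaussian_lt_normSq ha, stdComplexGaussian_lt_normSq hb,
    ENNReal.toReal_mul, ENNReal.toReal_ofReal (Real.exp_nonneg _),
    ENNReal.toReal_ofReal (Real.exp_nonneg _), ← Real.exp_add, neg_add]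

lemma IsRayleighPair.measureReal_inv_normSq_lt [IsProbabilityMeasure P]
    (hH : IsRayleighPair P H H') {U : Matrix (Fin N) (Fin N) ℂ}
    (hU : U ∈ Matrix.unitaryGroup (Fin N) ℂ) (m : Fin N) {v v' : Ω → Fin N → ℂ}
    (hv : ∀ᵐ ω ∂P, (H ω)ᴴ *ᵥ v ω = U.col m) (hv' : ∀ᵐ ω ∂P, (H' ω)ᴴ *ᵥ v' ω = U.col m)
    {b : ℝ} (hb : 0 ≤ b) :
    P.real {ω | (normSq (v' ω))⁻¹ < b} = 1 - Real.exp (-b) := by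
  have h := hH.measure_inv_normSq_and hU m hv hv' MeasurableSet.univ
    (measurableSet_Iio (a := b))
  have hm : MeasurableSet {z : ℂ | ‖z‖ ^ 2 < b} := measurableSet_lt (by fun_prop) measurable_const
  have hc : {z : ℂ | ‖z‖ ^ 2 < b}ᶜ = {z | b ≤ ‖z‖ ^ 2} := by ext; simp
  have hr : stdComplexGaussian.real {z : ℂ | ‖z‖ ^ 2 < b} = 1 - Real.exp (-b) := by
    rw [← compl_compl {z : ℂ | ‖z‖ ^ 2 < b}, probReal_compl_eq_one_sub hm.compl, hc,
      measureReal_def, stdComplexGaussian_le_normSq hb, ENNReal.toReal_ofReal (Real.exp_nonneg _)]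
  simp only [Set.mem_Iio, Set.mem_univ, true_and] at h
  rw [measureReal_def, h, ← hr]
  simp [measureReal_def]

end Square

end NomaIsac

/-! ### Assembly of the bounds and the closed forms -/

open NomaIsac in
theorem theorem3
    {M N L : ℕ} (hMN : M ≤ N) (hL : 0 < L)
    -- sensing-centric precoder: `R = U diag(lam) Uᴴ`, power budget `p`, powers `q`
    (p : ℝ) (R U : Matrix (Fin M) (Fin M) ℂ) (lam q : Fin M → ℝ)
    (hR : R.PosDef) (hdesign : IsSensingCentric L p R U lam q)
    -- the water-filling solution with total power `p`
    (ν : ℝ) (hν : ∑ i, waterFilling L lam ν i = p)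
    -- the considered pair, which is allotted a nonzero power
    (m : Fin M) (hs : 0 < waterFilling L lam ν m)
    -- power shares, path losses and target rates of the two users of the pair
    (α α' η η' t t' : ℝ) (hα : 0 < α) (hα' : 0 < α') (hαα' : α + α' = 1)
    (hη : 0 < η) (hη' : 0 < η') (ht : 0 ≤ t) (ht' : 0 ≤ t')
    -- channels and detection vectors of the two users of the pair
    {Ω : Type*} [MeasurableSpace Ω] (P : MeasureTheory.Measure Ω)
    [MeasureTheory.IsProbabilityMeasure P]
    (H H' : Ω → Matrix (Fin N) (Fin M) ℂ) (hH : IsRayleighPair P H H')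
    (v v' : Ω → Fin N → ℂ) (hv : AEMeasurable v P) (hv' : AEMeasurable v' P)
    (hva : ∀ᵐ ω ∂P, (H ω).conjTranspose.mulVec (v ω) = U.col m)
    (hva' : ∀ᵐ ω ∂P, (H' ω).conjTranspose.mulVec (v' ω) = U.col m) :
    let s : ℝ := waterFilling L lam ν m
    let rate : Ω → ℝ := fun ω => commRate (snrNear α η (q m) (H ω) (v ω) (U.col m))
    let rate' : Ω → ℝ := fun ω => commRate (sinrFar α α' η' (q m) (H' ω) (v' ω) (U.col m))
    let ρ : ℝ := thresholdNear α η t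
    let ρ' : ℝ := thresholdFar α η' t'
    (wishartMaxCDF N M (ρ / s) + wishartMaxCDF N M (ρ' / s)
        - wishartMaxCDF N M (ρ / s) * wishartMaxCDF N M (ρ' / s)
      ≤ outageNear P rate rate' t t') ∧
    (wishartMaxCDF N M (ρ' / s) ≤ outageFar P rate' t') ∧
    (N = M → (2 : ℝ) ^ t' * α < 1 →
      outageNear P rate rate' t t' = 1 - Real.exp (-((ρ + ρ') / s)) ∧
      outageFar P rate' t' = 1 - Real.exp (-(ρ' / s))) := by
  intro s rate rate' ρ ρ'
  have hM : 0 < M := Fin.pos m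
  have hN : 0 < N := hM.trans_le hMN
  have hU := hdesign.unitary
  have hu := normSq_col_of_mem_unitaryGroup hU m
  have hq : q m = s := hdesign.power_eq_waterFilling hL hR hν hs
  have hT : 1 ≤ (2 : ℝ) ^ t := Real.one_le_rpow (by norm_num) ht
  have hT' : 1 ≤ (2 : ℝ) ^ t' := Real.one_le_rpow (by norm_num) ht'
  have hs' : 0 < s := hs
  have hrate : ∀ᵐ ω ∂P, (t < rate ω ↔ ρ / s < (normSq (v ω))⁻¹) := by
    filter_upwards [hva] with ω h
    simp only [rate, hq]
    exact lt_commRate_snrNear_iff hα hη hs' h hu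
  rcases lt_or_ge ((2 : ℝ) ^ t' * α) 1 with hc | hc
  · have hlt : ∀ᵐ ω ∂P, (t' < rate' ω ↔ ρ' / s < (normSq (v' ω))⁻¹) := by
      filter_upwards [hva'] with ω h
      simp only [rate', hq]
      exact lt_commRate_sinrFar_iff hα hαα' hη' hs' hc h hu
    have hgt : ∀ᵐ ω ∂P, (rate' ω < t' ↔ (normSq (v' ω))⁻¹ < ρ' / s) := by
      filter_upwards [hva'] with ω h
      simp only [rate', hq]
      exact commRate_sinrFar_lt_iff hα hαα' hη' hs' hc h hu
    have hnear : outageNear P rate rate' t t' =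
        1 - P.real {ω | ρ / s < (normSq (v ω))⁻¹ ∧ ρ' / s < (normSq (v' ω))⁻¹} := by
      rw [outageNear]
      congr 1
      refine measureReal_congr ?_
      filter_upwards [hrate, hlt] with ω h h'
      exact propext (and_congr h h')
    have hfar : outageFar P rate' t' = P.real {ω | (normSq (v' ω))⁻¹ < ρ' / s} := by
      rw [outageFar]
      refine measureReal_congr ?_
      filter_upwards [hgt] with ω h
      exact propext h
    rw [hnear, hfar]
    refine ⟨?_, hH.wishartMaxCDF_le hN hM hu hva' _, ?_⟩
    · have := hH.measureReal_inv_normSq_le hN hu hva hva' (ρ / s) (ρ' / s)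
      linarith
    · intro hNM _
      subst hNM
      have hρ : 0 ≤ ρ / s :=
        div_nonneg (div_nonneg (by linarith) (mul_pos hα (inv_pos.2 hη)).le) hs'.le
      have hρ' : 0 ≤ ρ' / s := by
        refine div_nonneg (div_nonneg (by linarith) ?_) hs'.le
        nlinarith [inv_pos.2 hη']
      rw [hH.measureReal_lt_inv_normSq_and hU m hva hva' hρ hρ',
        hH.measureReal_inv_normSq_lt hU m hva hva' hρ', add_div]
      exact ⟨rfl, rfl⟩
  -- Here `ρ'` is nonpositive, or 0 by the division convention; its value plays no role.
  · have hgt : ∀ᵐ ω ∂P, rate' ω < t' := by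
      filter_upwards [hva'] with ω h
      simp only [rate', hq]
      exact commRate_sinrFar_lt_of_one_le hα hα' hαα' hη' hs' hc h hu
    have hnear : outageNear P rate rate' t t' = 1 := by
      have : P.real {ω | t < rate ω ∧ t' < rate' ω} = 0 := by
        rw [measureReal_eq_zero_iff, measure_eq_zero_iff_ae_notMem]
        filter_upwards [hgt] with ω h h'
        exact lt_asymm h h'.2
      rw [outageNear, this, sub_zero]
    have hfar : outageFar P rate' t' = 1 := by
      rw [outageFar, measureReal_congr (Filter.eventuallyEq_univ.2 hgt), probReal_univ]
    rw [hnear, hfar]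
    have h1 := wishartMaxCDF_le_one (N := N) (M := M) (ρ / s)
    have h2 := wishartMaxCDF_le_one (N := N) (M := M) (ρ' / s)
    refine ⟨?_, h2, fun _ h => absurd h (not_lt.2 hc)⟩
    nlinarith [mul_nonneg (sub_nonneg.2 h1) (sub_nonneg.2 h2)]
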